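/- Let $T>0$, $0<h\le T$, $\lambda_1,\lambda_2>0$, $\sigma>0$ and $\alpha_1\neq\alpha_2$ real. On a probability space let $\varepsilon=(\varepsilon_t)_{t\in[0,T]}$ be a right-continuous time-homogeneous Markov chain on $\{1,2\}$ that switches from $1$ to $2$ with intensity $\lambda_1$ and from $2$ to $1$ with intensity $\lambda_2$, i.e. with transition matrices $e^{tQ}$, $Q=\begin{pmatrix}-\lambda_1&\lambda_1\\ \lambda_2&-\lambda_2\end{pmatrix}$, and with $\mathbb P(\varepsilon_0=1)>0$. Let $W=(W_t)_{t\in[0,T]}$ be a standard Brownian motion independent of $\varepsilon$, and $$Z_h=\int_0^h\alpha_{\varepsilon_s}\,ds+\sigma W_h .$$ Put $a=\frac12(\alpha_1+\alpha_2)$, $b_1=\frac12(\alpha_1-\alpha_2)$, $\phi_s(x)=\frac1{\sqrt{2\pi}\,s}e^{-x^2/(2s^2)}$, $$B_0(z)=\sum_{k=0}^\infty\frac{(z^2/4)^k}{k!^2},\qquad B_1(z)=\frac z2\sum_{k=0}^\infty\frac{(z^2/4)^k}{k!\,(k+1)!},$$ and, for $x\in[-h,h)$, $$\tilde p_h(x)=\frac{\lambda_1}2\exp\Big(\frac{\lambda_1-\lambda_2}2(h-x)\Big)\Big[B_0\Big(\sqrt{\lambda_1\lambda_2(h^2-x^2)}\Big)+\Big(\frac{(h+x)\lambda_2}{(h-x)\lambda_1}\Big)^{1/2}B_1\Big(\sqrt{\lambda_1\lambda_2(h^2-x^2)}\Big)\Big],$$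 $$\tilde q_{h,+,1}(x)=\frac{\lambda_1}2\exp\Big(\frac{\lambda_1-\lambda_2}2(h-x)\Big)\Big(\frac{(h+x)\lambda_2}{(h-x)\lambda_1}\Big)^{1/2}B_1\Big(\sqrt{\lambda_1\lambda_2(h^2-x^2)}\Big),$$ $$\tilde q_{h,-,1}(x)=\frac12\exp\Big(\frac{\lambda_1-\lambda_2}2(h-x)\Big)B_0\Big(\sqrt{\lambda_1\lambda_2(h^2-x^2)}\Big).$$ Then all integrals below converge, and the following hold. The conditional distribution of $Z_h$ given $\varepsilon_0=1$ has the density $$g_1(z,h)=e^{-\lambda_1h}\Big[\phi_{\sigma\sqrt h}(z-h(b_1+a))+\frac1{|b_1|}\int_{h(a-|b_1|)}^{h(a+|b_1|)}\phi_{\sigma\sqrt h}(z-x)\,\tilde p_h\Big(\frac{x-ah}{b_1}\Big)dx\Big],\quad z\in\mathbb R.$$ The conditional distribution of $Z_h$ given $\varepsilon_0=\varepsilon_h=1$ has the density $$g_{11}(z,h)=\frac{\lambda_1+\lambda_2}{\lambda_2e^{\lambda_1h}+\lambda_1e^{-\lambda_2h}}\Big[\phi_{\sigma\sqrt h}(z-h(b_1+a))+\frac1{|b_1|}\int_{h(a-|b_1|)}^{h(a+|b_1|)}\phi_{\sigma\sqrt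 h}(z-x)\,\tilde q_{h,+,1}\Big(\frac{x-ah}{b_1}\Big)dx\Big],\quad z\in\mathbb R.$$ The conditional distribution of $Z_h$ given $\varepsilon_0=1,\ \varepsilon_h=2$ has the density $$g_{12}(z,h)=\frac{\lambda_1+\lambda_2}{e^{\lambda_1h}-e^{-\lambda_2h}}\cdot\frac1{|b_1|}\int_{h(a-|b_1|)}^{h(a+|b_1|)}\phi_{\sigma\sqrt h}(z-x)\,\tilde q_{h,-,1}\Big(\frac{x-ah}{b_1}\Big)dx,\quad z\in\mathbb R.$$ -/

import Mathlib

open MeasureTheory ProbabilityTheory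
open scoped NNReal ENNReal Topology

namespace HiddenChain

noncomputable section

variable {Ω E : Type*} [MeasurableSpace Ω]

/-! ### The model -/

/-- The transition matrix `e^{tQ}` of the time-homogeneous Markov chain with intensity matrix `Q`
over a time step `t`. -/
def transitionMatrix [Fintype E] [DecidableEq E] (Q : Matrix E E ℝ) (t : ℝ≥0) : Matrix E E ℝ :=
  NormedSpace.exp ((t : ℝ) • Q)

/-- `ε` is on `[0, T]` a time-homogeneous continuous-time Markov chain on the finite state space
`E` with intensity matrix `Q`: almost all its paths are right-continuous (for the discrete
topology on `E`), and it has the Markov property with transition matrices `e^{tQ}`, expressed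
through the finite-dimensional distributions. The initial distribution is arbitrary.
Values `ε t` with `T < t` play no role. -/
structure IsMarkovChainOn [Fintype E] [DecidableEq E] [MeasurableSpace E]
    (T : ℝ≥0) (Q : Matrix E E ℝ) (ε : ℝ≥0 → Ω → E) (P : Measure Ω) : Prop where
  measurable : ∀ t ≤ T, Measurable (ε t)
  right_continuous : ∀ᵐ ω ∂P, ∀ t < T, ∀ᶠ s in 𝓝[>] t, ε s ω = ε t ω
  finite_dimensional : ∀ (n : ℕ) (t : Fin (n + 1) → ℝ≥0) (i : Fin (n + 1) → E),
    Monotone t → (∀ k, t k ≤ T) →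
      P.real {ω | ∀ k, ε (t k) ω = i k} =
        P.real {ω | ε (t 0) ω = i 0} *
          ∏ k : Fin n, transitionMatrix Q (t k.succ - t k.castSucc) (i k.castSucc) (i k.succ)

/-- `W` is on `[0, T]` a standard real Brownian motion: the finite-dimensional laws at times
in `[0, T]` are those of Brownian motion and almost all paths are continuous on `[0, T]`.
Values `W t` with `T < t` play no role. -/
structure IsBrownianOn (T : ℝ≥0) (W : ℝ≥0 → Ω → ℝ) (P : Measure Ω) : Prop where
  hasLaw : ∀ I : Finset ℝ≥0, (∀ t ∈ I, t ≤ T) →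
    HasLaw (fun ω ↦ I.restrict (W · ω)) (BrownianReal.projectiveFamily I) P
  continuous : ∀ᵐ ω ∂P, ContinuousOn (W · ω) (Set.Iic T)

/-- The observation `Z_t = ∫₀ᵗ α(ε_s) ds + σ W_t`. -/
def observation (α : E → ℝ) (σ : ℝ) (ε : ℝ≥0 → Ω → E) (W : ℝ≥0 → Ω → ℝ) (t : ℝ≥0) (ω : Ω) : ℝ :=
  (∫ s in (0 : ℝ)..t, α (ε s.toNNReal ω)) + σ * W t ω

/-- The intensity matrix on two states, with rate `l₁` from the first state to the second and
rate `l₂` back. The states `1, 2` are the elements `0, 1` of `Fin 2`. -/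
def twoStateIntensity (l₁ l₂ : ℝ) : Matrix (Fin 2) (Fin 2) ℝ :=
  !![-l₁, l₁; l₂, -l₂]

/-- The function `g` is a probability density with respect to Lebesgue measure of the real random
variable `X` under the measure `P`. -/
structure IsDensityOf (g : ℝ → ℝ) (X : Ω → ℝ) (P : Measure Ω) : Prop where
  measurable : Measurable g
  nonneg : ∀ z, 0 ≤ g z
  hasLaw : HasLaw X (volume.withDensity fun z ↦ ENNReal.ofReal (g z)) P

/-! ### The explicit functions -/

/-- The modified Bessel function `B₀`. -/
def besselB0 (z : ℝ) : ℝ := ∑' k : ℕ, (z ^ 2 / 4) ^ k / (k.factorial : ℝ) ^ 2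

/-- The modified Bessel function `B₁`. -/
def besselB1 (z : ℝ) : ℝ :=
  z / 2 * ∑' k : ℕ, (z ^ 2 / 4) ^ k / ((k.factorial : ℝ) * ((k + 1).factorial : ℝ))

/-- The density of the centred normal distribution with standard deviation `s`. -/
def normalDensity (s x : ℝ) : ℝ :=
  1 / (√(2 * Real.pi) * s) * Real.exp (-(1 / 2) * (x ^ 2 / s ^ 2))

/-- `a = (α₁ + α₂) / 2`. -/
def meanDrift (α : Fin 2 → ℝ) : ℝ := (α 0 + α 1) / 2

/-- `b₁ = (α₁ - α₂) / 2`. -/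
def halfGap (α : Fin 2 → ℝ) : ℝ := (α 0 - α 1) / 2

/-- The kernel `p̃_h`, on `[-h, h]`. -/
def kernelP (l₁ l₂ h x : ℝ) : ℝ :=
  l₁ / 2 * Real.exp ((l₁ - l₂) / 2 * (h - x)) *
    (besselB0 √(l₁ * l₂ * (h ^ 2 - x ^ 2)) +
      √(((h + x) * l₂) / ((h - x) * l₁)) * besselB1 √(l₁ * l₂ * (h ^ 2 - x ^ 2)))

/-- The kernel `q̃_{h,+,1}`, on `[-h, h]`. -/
def kernelQPlus (l₁ l₂ h x : ℝ) : ℝ :=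
  l₁ / 2 * Real.exp ((l₁ - l₂) / 2 * (h - x)) *
    √(((h + x) * l₂) / ((h - x) * l₁)) * besselB1 √(l₁ * l₂ * (h ^ 2 - x ^ 2))

/-- The kernel `q̃_{h,-,1}`, on `[-h, h]`. -/
def kernelQMinus (l₁ l₂ h x : ℝ) : ℝ :=
  1 / 2 * Real.exp ((l₁ - l₂) / 2 * (h - x)) * besselB0 √(l₁ * l₂ * (h ^ 2 - x ^ 2))

/-- The Gaussian term `φ_{σ√h}(z - h (b₁ + a))`, coming from the paths without a switch. -/
def atomTerm (α : Fin 2 → ℝ) (σ h z : ℝ) : ℝ :=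
  normalDensity (σ * √h) (z - h * (halfGap α + meanDrift α))

/-- The integrand `x ↦ φ_{σ√h}(z - x) κ((x - a h) / b₁)`. -/
def convIntegrand (κ : ℝ → ℝ) (α : Fin 2 → ℝ) (σ h z x : ℝ) : ℝ :=
  normalDensity (σ * √h) (z - x) * κ ((x - meanDrift α * h) / halfGap α)

/-- The term `(1 / |b₁|) ∫ φ_{σ√h}(z - x) κ((x - a h) / b₁) dx`, with the integral from
`h (a - |b₁|)` to `h (a + |b₁|)`. -/
def convTerm (κ : ℝ → ℝ) (α : Fin 2 → ℝ) (σ h z : ℝ) : ℝ :=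
  1 / |halfGap α| *
    ∫ x in (h * (meanDrift α - |halfGap α|))..(h * (meanDrift α + |halfGap α|)),
      convIntegrand κ α σ h z x

/-- `g₁(z, h)`. -/
def densityOne (l₁ l₂ : ℝ) (α : Fin 2 → ℝ) (σ h z : ℝ) : ℝ :=
  Real.exp (-l₁ * h) * (atomTerm α σ h z + convTerm (kernelP l₁ l₂ h) α σ h z)

/-- `g₁₁(z, h)`. -/
def densityOneOne (l₁ l₂ : ℝ) (α : Fin 2 → ℝ) (σ h z : ℝ) : ℝ :=
  (l₁ + l₂) / (l₂ * Real.exp (l₁ * h) + l₁ * Real.exp (-l₂ * h)) *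
    (atomTerm α σ h z + convTerm (kernelQPlus l₁ l₂ h) α σ h z)

/-- `g₁₂(z, h)`. -/
def densityOneTwo (l₁ l₂ : ℝ) (α : Fin 2 → ℝ) (σ h z : ℝ) : ℝ :=
  (l₁ + l₂) / (Real.exp (l₁ * h) - Real.exp (-l₂ * h)) *
    convTerm (kernelQMinus l₁ l₂ h) α σ h z

end

end HiddenChain

open HiddenChain

/-! A finite measure on the line whose exponential moments are all finite is determined by them
(`ext_of_integral_exp_mul`). So it suffices to compare the moments of `Z_h` on each event `{ε_0 = 1,
ε_h = j}` with those of the proposed density.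

Probabilistic side (`setIntegral_exp_mul_observation`, a Feynman–Kac formula): by independence the
Brownian part contributes `exp ((θσ)² h / 2)`. With the time integral replaced by a Riemann sum, the
Markov property turns the chain part into `P(ε_0 = 1)` times an entry of `(e^{hQ/n} e^{hθ
diag(α)/n})^n`. The Lie product formula gives the limit `e^{h(Q + θ diag α)}`.

Analytic side: the substitution `x = α₁ u + α₂ (h - u)`, with `u` the time spent in state `1`, turns
each convolution into a Gaussian mixture, whose moments follow from Fubini. They match because the
first row of the exponential of a two-by-two matrix is an integral over `u` of exponentials times
Bessel series, plus a term `e^{ah}` for paths without a switch (`exp_smul_matrix_fin_two`). Taking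
`θ = 0` gives the probabilities of the events, hence the normalising constants, and `g₁` is the sum
over the two end states. -/

namespace HiddenChain

/-! ### The Bessel series -/

/-- The entire function `y ↦ ∑ yᵏ / (k! (k + m)!)`. -/
noncomputable def besselSeries (m : ℕ) (y : ℝ) : ℝ :=
  ∑' k : ℕ, y ^ k / ((k.factorial : ℝ) * ((k + m).factorial : ℝ))

lemma summable_besselSeries (m : ℕ) (y : ℝ) :
    Summable fun k : ℕ ↦ y ^ k / ((k.factorial : ℝ) * ((k + m).factorial : ℝ)) := by
  refine Summable.of_norm_bounded (Real.summable_pow_div_factorial |y|) fun k ↦ ?_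
  rw [Real.norm_eq_abs, abs_div, abs_pow, abs_of_pos (by positivity : (0:ℝ) < k.factorial * (k + m).factorial)]
  have h1 : (1 : ℝ) ≤ (k + m).factorial := by exact_mod_cast Nat.one_le_iff_ne_zero.2 (Nat.factorial_ne_zero _)
  have h2 : (0 : ℝ) < k.factorial := by positivity
  gcongr
  nlinarith

lemma besselSeries_nonneg (m : ℕ) {y : ℝ} (hy : 0 ≤ y) : 0 ≤ besselSeries m y :=
  tsum_nonneg fun k ↦ by positivity

/-- Termwise differentiation cancels one factor of `k!`, and shifting the index turns `(k + m)!`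
into `(k + m + 1)!`. The terms at `r = |y| + 1` dominate on `(-r, r)`. -/
lemma hasDerivAt_besselSeries (m : ℕ) (y : ℝ) :
    HasDerivAt (besselSeries m) (besselSeries (m + 1) y) y := by
  set r : ℝ := |y| + 1
  have hterm (k : ℕ) (z : ℝ) :
      HasDerivAt (fun z : ℝ ↦ z ^ k / ((k.factorial : ℝ) * ((k + m).factorial : ℝ)))
        (k * z ^ (k - 1) / ((k.factorial : ℝ) * ((k + m).factorial : ℝ))) z :=
    (hasDerivAt_pow k z).div_const _
  have hsucc (k : ℕ) (z : ℝ) :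
      ((k + 1 : ℕ) : ℝ) * z ^ (k + 1 - 1) / (((k + 1).factorial : ℝ) * ((k + 1 + m).factorial : ℝ)) =
        z ^ k / ((k.factorial : ℝ) * ((k + (m + 1)).factorial : ℝ)) := by
    rw [show k + 1 + m = k + (m + 1) by ring, Nat.factorial_succ k]
    push_cast
    have : ((k : ℝ) + 1) ≠ 0 := by positivity
    field_simp
  have key := hasDerivAt_tsum_of_isPreconnected (t := Set.Ioo (-r) r) (y₀ := y) (y := y)
    (u := fun k : ℕ ↦ (k * r ^ (k - 1) / ((k.factorial : ℝ) * ((k + m).factorial : ℝ))))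
    ?_ isOpen_Ioo isPreconnected_Ioo (fun k z _ ↦ hterm k z) ?_ ?_ (summable_besselSeries m y) ?_
  · convert! key using 1
    rw [Summable.tsum_eq_zero_add]
    · simp only [hsucc]
      simp [besselSeries]
    · rw [← summable_nat_add_iff 1]
      simp only [hsucc]
      exact summable_besselSeries (m + 1) y
  · rw [← summable_nat_add_iff 1]
    simp only [hsucc]
    exact summable_besselSeries (m + 1) r
  · intro k z hz
    have : |z| ≤ r := abs_le.2 ⟨hz.1.le, hz.2.le⟩
    rw [Real.norm_eq_abs, abs_div, abs_mul, abs_pow, Nat.abs_cast,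
      abs_of_pos (by positivity : (0:ℝ) < k.factorial * (k + m).factorial)]
    gcongr
  all_goals
    rw [Set.mem_Ioo, ← abs_lt]
    simp [r]

@[fun_prop]
lemma continuous_besselSeries (m : ℕ) : Continuous (besselSeries m) :=
  continuous_iff_continuousAt.2 fun y ↦ (hasDerivAt_besselSeries m y).continuousAt

/-- The Bessel recurrence, from `1/(k+1)!² = (1 + (k+1)) / ((k+1)! (k+2)!)`. It closes the
differential system satisfied by the matrix exponential. -/
lemma besselSeries_zero_eq (y : ℝ) :
    besselSeries 0 y = besselSeries 1 y + y * besselSeries 2 y := by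
  simp only [besselSeries, ← tsum_mul_left]
  rw [(summable_besselSeries 0 y).tsum_eq_zero_add, (summable_besselSeries 1 y).tsum_eq_zero_add,
    add_assoc, ← Summable.tsum_add]
  · congr 1
    · refine tsum_congr fun k ↦ ?_
      rw [show k + 1 + 0 = k + 1 by ring, show k + 1 + 1 = k + 2 by ring,
        Nat.factorial_succ (k + 1), Nat.factorial_succ k]
      push_cast
      have : ((k : ℝ) + 1) ≠ 0 := by positivity
      have : ((k : ℝ) + 2) ≠ 0 := by positivity
      have : ((k : ℝ) + 1 + 1) ≠ 0 := by positivity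
      field_simp
      ring
  · exact (summable_nat_add_iff 1).2 (summable_besselSeries 1 y)
  · exact (summable_besselSeries 2 y).mul_left y

lemma besselB0_sqrt {w : ℝ} (hw : 0 ≤ w) : besselB0 √(4 * w) = besselSeries 0 w := by
  simp only [besselB0, besselSeries, add_zero]
  rw [Real.sq_sqrt (by positivity)]
  refine tsum_congr fun k ↦ ?_
  rw [pow_two]
  congr 2
  ring

lemma besselB1_sqrt {w : ℝ} (hw : 0 ≤ w) : besselB1 √(4 * w) = √w * besselSeries 1 w := by
  simp only [besselB1, besselSeries]
  rw [Real.sq_sqrt (by positivity), mul_div_cancel_left₀ _ (by norm_num), Real.sqrt_mul (by norm_num),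
    show (4 : ℝ) = 2 ^ 2 by norm_num, Real.sqrt_sq (by norm_num)]
  ring

/-! ### Integrals of the form `∫₀ˣ K(u, x - u) du` -/

lemma hasDerivAt_integral_zero_one {F F' : ℝ → ℝ → ℝ} (hF : Continuous (Function.uncurry F))
    (hF' : Continuous (Function.uncurry F'))
    (hd : ∀ x t, HasDerivAt (F · t) (F' x t) x) (x : ℝ) :
    HasDerivAt (fun x ↦ ∫ t in (0 : ℝ)..1, F x t) (∫ t in (0 : ℝ)..1, F' x t) x := by
  obtain ⟨C, hC⟩ := ((isCompact_Icc (a := x - 1) (b := x + 1)).prod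
    (isCompact_Icc (a := (0 : ℝ)) (b := 1))).exists_bound_of_continuousOn hF'.continuousOn
  have hc (y : ℝ) : Continuous (F y) := hF.comp (by fun_prop : Continuous fun t ↦ (y, t))
  have hc' (y : ℝ) : Continuous (F' y) := hF'.comp (by fun_prop : Continuous fun t ↦ (y, t))
  refine (intervalIntegral.hasDerivAt_integral_of_dominated_loc_of_deriv_le
    (s := Set.Icc (x - 1) (x + 1)) (bound := fun _ ↦ C) (Icc_mem_nhds (by linarith) (by linarith))
    (.of_forall fun y ↦ (hc y).aestronglyMeasurable) ((hc x).intervalIntegrable _ _)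
    (hc' x).aestronglyMeasurable (.of_forall fun t ht y hy ↦ ?_) (by simp)
    (.of_forall fun t _ y _ ↦ hd y t)).2
  rw [Set.uIoc_of_le zero_le_one] at ht
  exact hC (y, t) ⟨hy, ht.1.le, ht.2⟩

/-- `Ku` and `Kv` play the role of partial derivatives, given through the chain rule `hd`. Rescaling
to `[0, 1]` fixes the domain and produces the mixed derivative `t Ku + (1 - t) Kv`; integrating
total derivatives in `t` trades it for `Kv` alone or `Ku` alone, at the price of a boundary value of
`K`. Both forms are needed, one for each entry of the matrix row. -/
lemma hasDerivAt_integral_antidiagonal {K Ku Kv : ℝ → ℝ → ℝ}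
    (hK : Continuous (Function.uncurry K)) (hKu : Continuous (Function.uncurry Ku))
    (hKv : Continuous (Function.uncurry Kv))
    (hd : ∀ (u v : ℝ → ℝ) (u' v' t : ℝ), HasDerivAt u u' t → HasDerivAt v v' t →
      HasDerivAt (fun s ↦ K (u s) (v s)) (u' * Ku (u t) (v t) + v' * Kv (u t) (v t)) t) (x : ℝ) :
    HasDerivAt (fun x ↦ ∫ u in (0 : ℝ)..x, K u (x - u))
        (K x 0 + ∫ u in (0 : ℝ)..x, Kv u (x - u)) x ∧
      HasDerivAt (fun x ↦ ∫ u in (0 : ℝ)..x, K u (x - u))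
        (K 0 x + ∫ u in (0 : ℝ)..x, Ku u (x - u)) x := by
  have hscale (G : ℝ → ℝ → ℝ) (x : ℝ) :
      ∫ u in (0 : ℝ)..x, G u (x - u) = x * ∫ t in (0 : ℝ)..1, G (x * t) (x * (1 - t)) := by
    have := intervalIntegral.mul_integral_comp_mul_left (a := 0) (b := 1) (f := fun u ↦ G u (x - u)) (c := x)
    rw [mul_zero, mul_one] at this
    rw [← this]
    simp only [mul_sub, mul_one]
  have hcomp {G : ℝ → ℝ → ℝ} (hG : Continuous (Function.uncurry G)) {a b : ℝ × ℝ → ℝ}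
      (ha : Continuous a) (hb : Continuous b) : Continuous fun p ↦ G (a p) (b p) :=
    hG.comp (ha.prodMk hb)
  have hcomp1 {G : ℝ → ℝ → ℝ} (hG : Continuous (Function.uncurry G)) {a b : ℝ → ℝ}
      (ha : Continuous a) (hb : Continuous b) : Continuous fun p ↦ G (a p) (b p) :=
    hG.comp (ha.prodMk hb)
  have hmain : HasDerivAt (fun x ↦ ∫ u in (0 : ℝ)..x, K u (x - u))
      (1 * (∫ t in (0 : ℝ)..1, K (x * t) (x * (1 - t))) + x * ∫ t in (0 : ℝ)..1,
        (t * Ku (x * t) (x * (1 - t)) + (1 - t) * Kv (x * t) (x * (1 - t)))) x := by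
    simp only [hscale K]
    refine (hasDerivAt_id x).mul (hasDerivAt_integral_zero_one (F := fun x t ↦ K (x * t) (x * (1 - t)))
      (F' := fun x t ↦ t * Ku (x * t) (x * (1 - t)) + (1 - t) * Kv (x * t) (x * (1 - t)))
      ?_ ?_ (fun y t ↦ ?_) x)
    · exact hcomp hK (by fun_prop) (by fun_prop)
    · exact (continuous_snd.mul (hcomp hKu (by fun_prop) (by fun_prop))).add
        ((by fun_prop : Continuous fun p : ℝ × ℝ ↦ 1 - p.2).mul
          (hcomp hKv (by fun_prop) (by fun_prop)))
    · simpa using hd (fun y ↦ y * t) (fun y ↦ y * (1 - t)) t (1 - t) y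
        (by simpa using (hasDerivAt_id y).mul_const t)
        (by simpa using (hasDerivAt_id y).mul_const (1 - t))
  have hlin (t : ℝ) : HasDerivAt (fun t ↦ x * (1 - t)) (-x) t := by
    simpa using ((hasDerivAt_id t).const_sub 1).const_mul x
  have hlin' (t : ℝ) : HasDerivAt (fun t ↦ x * t) x t := by
    simpa using (hasDerivAt_id t).const_mul x
  have iK : IntervalIntegrable (fun t ↦ K (x * t) (x * (1 - t))) volume 0 1 :=
    (hcomp1 hK (by fun_prop) (by fun_prop)).intervalIntegrable _ _
  have iKu : IntervalIntegrable (fun t ↦ Ku (x * t) (x * (1 - t))) volume 0 1 :=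
    (hcomp1 hKu (by fun_prop) (by fun_prop)).intervalIntegrable _ _
  have iKv : IntervalIntegrable (fun t ↦ Kv (x * t) (x * (1 - t))) volume 0 1 :=
    (hcomp1 hKv (by fun_prop) (by fun_prop)).intervalIntegrable _ _
  have jKu : IntervalIntegrable (fun t ↦ t * Ku (x * t) (x * (1 - t))) volume 0 1 :=
    (continuous_id.mul (hcomp1 hKu (by fun_prop) (by fun_prop))).intervalIntegrable _ _
  have jKv : IntervalIntegrable (fun t ↦ t * Kv (x * t) (x * (1 - t))) volume 0 1 :=
    (continuous_id.mul (hcomp1 hKv (by fun_prop) (by fun_prop))).intervalIntegrable _ _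
  -- The total derivative of `t K(xt, x(1 - t))`; that of `K(xt, x(1 - t))` follows in `hftc'`.
  have hftc : ∫ t in (0 : ℝ)..1, (K (x * t) (x * (1 - t)) + x * (t * Ku (x * t) (x * (1 - t)))
      - x * (t * Kv (x * t) (x * (1 - t)))) = K x 0 := by
    rw [intervalIntegral.integral_eq_sub_of_hasDerivAt (f := fun t ↦ t * K (x * t) (x * (1 - t)))]
    · simp
    · intro t _
      convert! (hasDerivAt_id t).mul (hd _ _ _ _ t (hlin' t) (hlin t)) using 1
      simp
      ring
    · exact (iK.add (jKu.const_mul x)).sub (jKv.const_mul x)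
  have hftc' : ∫ t in (0 : ℝ)..1, (x * Ku (x * t) (x * (1 - t)) - x * Kv (x * t) (x * (1 - t)))
      = K x 0 - K 0 x := by
    rw [intervalIntegral.integral_eq_sub_of_hasDerivAt (f := fun t ↦ K (x * t) (x * (1 - t)))]
    · simp
    · intro t _
      convert! hd _ _ _ _ t (hlin' t) (hlin t) using 1
      ring
    · exact (iKu.const_mul x).sub (iKv.const_mul x)
  rw [intervalIntegral.integral_sub (iK.add (jKu.const_mul x)) (jKv.const_mul x),
    intervalIntegral.integral_add iK (jKu.const_mul x), intervalIntegral.integral_const_mul,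
    intervalIntegral.integral_const_mul] at hftc
  rw [intervalIntegral.integral_sub (iKu.const_mul x) (iKv.const_mul x),
    intervalIntegral.integral_const_mul, intervalIntegral.integral_const_mul] at hftc'
  have hsum : ∫ t in (0 : ℝ)..1, (t * Ku (x * t) (x * (1 - t)) + (1 - t) * Kv (x * t) (x * (1 - t)))
      = (∫ t in (0 : ℝ)..1, t * Ku (x * t) (x * (1 - t))) +
        ((∫ t in (0 : ℝ)..1, Kv (x * t) (x * (1 - t))) -
          ∫ t in (0 : ℝ)..1, t * Kv (x * t) (x * (1 - t))) := by
    rw [← intervalIntegral.integral_sub iKv jKv, ← intervalIntegral.integral_add jKu (iKv.sub jKv)]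
    simp only [sub_mul, one_mul]
  rw [hsum] at hmain
  rw [hscale Kv, hscale Ku]
  constructor <;> convert! hmain using 1 <;> linarith

/-! ### Powers close to the identity -/

lemma norm_pow_sub_pow_le_of_norm_le {𝔸 : Type*} [NormedRing 𝔸] [NormOneClass 𝔸] {x y : 𝔸} {r : ℝ} (hr : 1 ≤ r)
    (hx : ‖x‖ ≤ r) (hy : ‖y‖ ≤ r) (n : ℕ) : ‖x ^ n - y ^ n‖ ≤ n * r ^ n * ‖x - y‖ := by
  induction n with
  | zero => simp
  | succ n ih =>
    have hr0 : 0 ≤ r := zero_le_one.trans hr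
    have hyn : ‖y ^ n‖ ≤ r ^ (n + 1) := ((norm_pow_le y n).trans (pow_le_pow_left₀ (norm_nonneg _) hy n)).trans
      (pow_le_pow_right₀ hr n.le_succ)
    calc ‖x ^ (n + 1) - y ^ (n + 1)‖ = ‖x * (x ^ n - y ^ n) + (x - y) * y ^ n‖ := by
          congr 1
          rw [pow_succ', pow_succ']
          noncomm_ring
      _ ≤ ‖x‖ * ‖x ^ n - y ^ n‖ + ‖x - y‖ * ‖y ^ n‖ :=
          (norm_add_le _ _).trans (add_le_add (norm_mul_le _ _) (norm_mul_le _ _))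
      _ ≤ r * (n * r ^ n * ‖x - y‖) + ‖x - y‖ * r ^ (n + 1) := by gcongr
      _ = (n + 1 : ℕ) * r ^ (n + 1) * ‖x - y‖ := by push_cast; ring

open Filter in
-- Both sequences are `1 + c/n + o(1/n)`. Their norms are at most `1 + K/n`, whose `n`-th power is
-- at most `e^K`, so the telescoping bound leaves `e^K n ‖x n - y n‖ → 0`.
lemma tendsto_pow_sub_pow_of_tendsto_mul_sub_one {𝔸 : Type*} [NormedRing 𝔸] [NormOneClass 𝔸]
    [NormedAlgebra ℝ 𝔸] {x y : ℕ → 𝔸} {c : 𝔸}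
    (hx : Tendsto (fun n : ℕ ↦ (n : ℝ) • (x n - 1)) atTop (𝓝 c))
    (hy : Tendsto (fun n : ℕ ↦ (n : ℝ) • (y n - 1)) atTop (𝓝 c)) :
    Tendsto (fun n ↦ x n ^ n - y n ^ n) atTop (𝓝 0) := by
  set K := ‖c‖ + 1
  have hbd {z : ℕ → 𝔸} (hz : Tendsto (fun n : ℕ ↦ (n : ℝ) • (z n - 1)) atTop (𝓝 c)) :
      ∀ᶠ n : ℕ in atTop, ‖z n‖ ≤ 1 + K / n := by
    filter_upwards [hz.norm.eventually_le_const (lt_add_one ‖c‖), eventually_gt_atTop 0] with n hn h0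
    have hn0 : (0 : ℝ) < n := by exact_mod_cast h0
    rw [norm_smul, Real.norm_of_nonneg hn0.le] at hn
    calc ‖z n‖ = ‖1 + (z n - 1)‖ := by rw [add_sub_cancel]
      _ ≤ ‖(1 : 𝔸)‖ + ‖z n - 1‖ := norm_add_le _ _
      _ ≤ 1 + K / n := by
        rw [norm_one]
        gcongr
        rwa [le_div_iff₀' hn0]
  have hdiff : Tendsto (fun n : ℕ ↦ Real.exp K * ‖(n : ℝ) • (x n - 1) - (n : ℝ) • (y n - 1)‖) atTop (𝓝 0) := by
    simpa using ((hx.sub hy).norm.const_mul (Real.exp K))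
  refine squeeze_zero_norm' ?_ hdiff
  filter_upwards [hbd hx, hbd hy, eventually_gt_atTop 0] with n hxn hyn h0
  have hn0 : (0 : ℝ) < n := by exact_mod_cast h0
  have hK : 0 ≤ K / n := by positivity
  refine (norm_pow_sub_pow_le_of_norm_le (by linarith) hxn hyn n).trans ?_
  have hexp : (1 + K / n) ^ n ≤ Real.exp K := by
    calc (1 + K / n) ^ n ≤ Real.exp (K / n) ^ n := by
          gcongr
          linarith [Real.add_one_le_exp (K / n)]
      _ = Real.exp K := by
          rw [← Real.exp_nat_mul]
          congr 1
          field_simp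
  rw [← smul_sub, sub_sub_sub_cancel_right, norm_smul, Real.norm_of_nonneg hn0.le]
  calc _ ≤ n * Real.exp K * ‖x n - y n‖ := by gcongr
    _ = _ := by ring

open Filter in
/-- The Lie product formula. -/
theorem tendsto_exp_mul_exp_pow {𝔸 : Type*} [NormedRing 𝔸] [NormOneClass 𝔸] [NormedAlgebra ℝ 𝔸]
    [CompleteSpace 𝔸] (a b : 𝔸) :
    Tendsto (fun n : ℕ ↦ (NormedSpace.exp ((n : ℝ)⁻¹ • a) * NormedSpace.exp ((n : ℝ)⁻¹ • b)) ^ n)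
      atTop (𝓝 (NormedSpace.exp (a + b))) := by
  -- Applied to `exp (t a) exp (t b)` and to `exp (t (a + b))`, which share the derivative `a + b`
  -- at `0`.
  have hslope {F : ℝ → 𝔸} {c : 𝔸} (hF : HasDerivAt F c 0) (h0 : F 0 = 1) :
      Tendsto (fun n : ℕ ↦ (n : ℝ) • (F (n : ℝ)⁻¹ - 1)) atTop (𝓝 c) := by
    have h := hF.tendsto_slope_zero_right.comp tendsto_inv_atTop_nhdsGT_zero
    simpa [Function.comp_def, h0] using h.comp tendsto_natCast_atTop_atTop
  have hexp (z : 𝔸) : HasDerivAt (fun t : ℝ ↦ NormedSpace.exp (t • z)) z 0 := by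
    simpa using hasDerivAt_exp_smul_const (𝕂 := ℝ) z (0 : ℝ)
  have hab := hslope ((hexp a).mul (hexp b)) (by simp)
  have hsum := hslope (hexp (a + b)) (by simp)
  have key := tendsto_pow_sub_pow_of_tendsto_mul_sub_one (by simpa using hab) hsum
  have := key.add_const (NormedSpace.exp (a + b))
  rw [zero_add] at this
  refine this.congr' ?_
  filter_upwards [eventually_gt_atTop 0] with n hn
  have hn0 : (n : ℝ) ≠ 0 := by exact_mod_cast hn.ne'
  let _ : NormedAlgebra ℚ 𝔸 := NormedAlgebra.restrictScalars ℚ ℝ 𝔸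
  rw [← NormedSpace.exp_nsmul n ((n : ℝ)⁻¹ • (a + b)), ← Nat.cast_smul_eq_nsmul ℝ n, smul_smul,
    mul_inv_cancel₀ hn0, one_smul]
  simp

/-! ### The exponential of a two-by-two matrix -/

section

attribute [local instance] Matrix.linftyOpNormedRing Matrix.linftyOpNormedAlgebra
  Matrix.linfty_opNormOneClass

lemma hasDerivAt_exp_smul_matrix_apply {ι : Type*} [Fintype ι] [DecidableEq ι] (M : Matrix ι ι ℝ)
    (t : ℝ) (i j : ι) :
    HasDerivAt (fun t : ℝ ↦ NormedSpace.exp (t • M) i j) ((M * NormedSpace.exp (t • M)) i j) t := by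
  have h := hasDerivAt_exp_smul_const' (𝕂 := ℝ) M t
  exact hasDerivAt_pi.1 (hasDerivAt_pi.1 h i) j

open Filter in
/-- The Lie product formula for real matrices. -/
lemma tendsto_matrix_exp_mul_exp_pow {ι : Type*} [Fintype ι] [DecidableEq ι] [Nonempty ι]
    (A B : Matrix ι ι ℝ) (i j : ι) :
    Tendsto (fun n : ℕ ↦ ((NormedSpace.exp ((n : ℝ)⁻¹ • A) * NormedSpace.exp ((n : ℝ)⁻¹ • B)) ^ n) i j)
      atTop (𝓝 (NormedSpace.exp (A + B) i j)) :=
  tendsto_pi_nhds.1 (tendsto_pi_nhds.1 (tendsto_exp_mul_exp_pow A B) i) j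

end

/-- Uniqueness for the linear system `(f, g)' = (f, g) M`: the row `(f t, g t) exp ((h - t) M)` has
zero derivative, and its values at `t = 0` and `t = h` are compared. -/
lemma exp_smul_matrix_fin_two_row {a b c d : ℝ} {f g : ℝ → ℝ}
    (hf : ∀ t, HasDerivAt f (a * f t + c * g t) t) (hg : ∀ t, HasDerivAt g (b * f t + d * g t) t)
    (hf0 : f 0 = 1) (hg0 : g 0 = 0) (h : ℝ) :
    NormedSpace.exp (h • !![a, b; c, d]) 0 0 = f h ∧ NormedSpace.exp (h • !![a, b; c, d]) 0 1 = g h := by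
  set M := !![a, b; c, d]
  have key (j : Fin 2) : NormedSpace.exp (h • M) 0 j =
      f h * (1 : Matrix (Fin 2) (Fin 2) ℝ) 0 j + g h * (1 : Matrix (Fin 2) (Fin 2) ℝ) 1 j := by
    have hN (t : ℝ) (i : Fin 2) : HasDerivAt (fun t ↦ NormedSpace.exp ((h - t) • M) i j)
        (-(M * NormedSpace.exp ((h - t) • M)) i j) t := by
      have := (hasDerivAt_exp_smul_matrix_apply M (h - t) i j).comp t ((hasDerivAt_id t).const_sub h)
      simpa [Function.comp_def] using this
    have hd (t : ℝ) : HasDerivAt (fun t ↦ f t * NormedSpace.exp ((h - t) • M) 0 j +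
        g t * NormedSpace.exp ((h - t) • M) 1 j) 0 t := by
      convert! ((hf t).mul (hN t 0)).add ((hg t).mul (hN t 1)) using 1
      simp only [Matrix.mul_apply, Fin.sum_univ_two, M, Matrix.cons_val', Matrix.of_apply, Matrix.cons_val_zero,
        Matrix.cons_val_one, Matrix.cons_val_fin_one]
      ring
    have := is_const_of_deriv_eq_zero (fun t ↦ (hd t).differentiableAt) (fun t ↦ (hd t).deriv) 0 h
    simpa [hf0, hg0] using this
  constructor
  · simp [key 0]
  · simp [key 1]

/-- The first row of the exponential of `h • !![a, b; c, d]`. -/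
theorem exp_smul_matrix_fin_two (a b c d h : ℝ) :
    NormedSpace.exp (h • !![a, b; c, d]) 0 0 = Real.exp (a * h) +
        ∫ u in (0 : ℝ)..h, Real.exp (a * u + d * (h - u)) *
          (b * c * u * besselSeries 1 (b * c * (u * (h - u)))) ∧
      NormedSpace.exp (h • !![a, b; c, d]) 0 1 =
        ∫ u in (0 : ℝ)..h, Real.exp (a * u + d * (h - u)) *
          (b * besselSeries 0 (b * c * (u * (h - u)))) := by
  have hexp {u v : ℝ → ℝ} {u' v' t : ℝ} (hu : HasDerivAt u u' t) (hv : HasDerivAt v v' t) :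
      HasDerivAt (fun s ↦ Real.exp (a * u s + d * v s))
        (Real.exp (a * u t + d * v t) * (a * u' + d * v')) t :=
    ((hu.const_mul a).add (hv.const_mul d)).exp
  have hbes (m : ℕ) {u v : ℝ → ℝ} {u' v' t : ℝ} (hu : HasDerivAt u u' t) (hv : HasDerivAt v v' t) :
      HasDerivAt (fun s ↦ besselSeries m (b * c * (u s * v s)))
        (besselSeries (m + 1) (b * c * (u t * v t)) * (b * c * (u' * v t + u t * v'))) t :=
    (hasDerivAt_besselSeries m _).comp t ((hu.mul hv).const_mul (b * c))
  set K : ℝ → ℝ → ℝ := fun u v ↦ Real.exp (a * u + d * v) * (b * c * u * besselSeries 1 (b * c * (u * v)))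
  set L : ℝ → ℝ → ℝ := fun u v ↦ Real.exp (a * u + d * v) * (b * besselSeries 0 (b * c * (u * v)))
  have hK : Continuous (Function.uncurry K) := by
    simp only [Function.uncurry_def, K]; fun_prop
  have hL : Continuous (Function.uncurry L) := by
    simp only [Function.uncurry_def, L]; fun_prop
  have iK (x : ℝ) : IntervalIntegrable (fun u ↦ K u (x - u)) volume 0 x :=
    (hK.comp (by fun_prop : Continuous fun u ↦ (u, x - u))).intervalIntegrable _ _
  have iL (x : ℝ) : IntervalIntegrable (fun u ↦ L u (x - u)) volume 0 x :=
    (hL.comp (by fun_prop : Continuous fun u ↦ (u, x - u))).intervalIntegrable _ _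
  -- By the Bessel recurrence `∂K/∂u = a K + c L`, and the boundary value `K 0 x` vanishes.
  have hfirst (x : ℝ) := (hasDerivAt_integral_antidiagonal (K := K)
    (Ku := fun u v ↦ a * K u v + c * L u v)
    (Kv := fun u v ↦ Real.exp (a * u + d * v) * (d * (b * c * u * besselSeries 1 (b * c * (u * v))) +
      b * c * u * (besselSeries 2 (b * c * (u * v)) * (b * c * u)))) hK
    (by simp only [Function.uncurry_def, K, L]; fun_prop)
    (by simp only [Function.uncurry_def]; fun_prop) (by
      intro u v u' v' t hu hv
      convert! (hexp hu hv).mul ((hu.const_mul (b * c)).mul (hbes 1 hu hv)) using 1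
      simp only [K, L, besselSeries_zero_eq, Pi.mul_apply]
      ring) x).2
  -- Here `∂L/∂v = b K + d L`, and the boundary value `L x 0 = b e^{ax}` supplies the no-switch term
  -- of `f`.
  have hsecond (x : ℝ) := (hasDerivAt_integral_antidiagonal (K := L)
    (Ku := fun u v ↦ Real.exp (a * u + d * v) * (a * (b * besselSeries 0 (b * c * (u * v))) +
      b * (besselSeries 1 (b * c * (u * v)) * (b * c * v))))
    (Kv := fun u v ↦ b * K u v + d * L u v) hL
    (by simp only [Function.uncurry_def]; fun_prop)
    (by simp only [Function.uncurry_def, K, L]; fun_prop) (by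
      intro u v u' v' t hu hv
      convert! (hexp hu hv).mul ((hbes 0 hu hv).const_mul b) using 1
      simp only [K, L]
      ring) x).1
  refine exp_smul_matrix_fin_two_row
    (f := fun h ↦ Real.exp (a * h) + ∫ u in (0 : ℝ)..h, K u (h - u))
    (g := fun h ↦ ∫ u in (0 : ℝ)..h, L u (h - u)) (fun x ↦ ?_) (fun x ↦ ?_) (by simp) (by simp) h
  · convert! (((hasDerivAt_id x).const_mul a).exp).add (hfirst x) using 1
    rw [intervalIntegral.integral_add ((iK x).const_mul a) ((iL x).const_mul c),
      intervalIntegral.integral_const_mul, intervalIntegral.integral_const_mul]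
    simp [K]
    ring
  · convert! hsecond x using 1
    rw [intervalIntegral.integral_add ((iK x).const_mul b) ((iL x).const_mul d),
      intervalIntegral.integral_const_mul, intervalIntegral.integral_const_mul]
    have : besselSeries 0 0 = 1 := by
      rw [besselSeries, tsum_eq_single 0]
      · simp
      · intro k hk; simp [hk]
    simp [L, this]
    ring

/-! ### Riemann sums of right-continuous paths -/

/-- The grid point `(k + 1) h / n`. -/
noncomputable def gridPoint (h : ℝ≥0) (n k : ℕ) : ℝ≥0 := h * k / n

lemma gridPoint_le (h : ℝ≥0) {n k : ℕ} (hk : k ≤ n) : gridPoint h n k ≤ h := by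
  rcases n.eq_zero_or_pos with rfl | hn
  · simp [gridPoint]
  · rw [gridPoint, div_le_iff₀ (by exact_mod_cast hn)]
    gcongr

/-- The right-endpoint Riemann sum of `f` on `[0, h]` with `n` steps. -/
noncomputable def riemannSum (f : ℝ≥0 → ℝ) (h : ℝ≥0) (n : ℕ) : ℝ :=
  ∑ k : Fin n, (h : ℝ) / n * f (gridPoint h n (k + 1))

lemma abs_riemannSum_le {f : ℝ≥0 → ℝ} {C : ℝ} (hC : 0 ≤ C) (hf : ∀ t, |f t| ≤ C) (h : ℝ≥0) (n : ℕ) :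
    |riemannSum f h n| ≤ h * C := by
  refine (Finset.abs_sum_le_sum_abs _ _).trans ?_
  calc ∑ k : Fin n, |(h : ℝ) / n * f (gridPoint h n (k + 1))| ≤ ∑ k : Fin n, (h : ℝ) / n * C := by
        refine Finset.sum_le_sum fun k _ ↦ ?_
        rw [abs_mul, abs_of_nonneg (by positivity : (0 : ℝ) ≤ h / n)]
        gcongr
        exact hf _
    _ ≤ h * C := by
        rcases n.eq_zero_or_pos with rfl | hn
        · simp; positivity
        · have : (n : ℝ) ≠ 0 := by exact_mod_cast hn.ne'
          simp only [Finset.sum_const, Finset.card_univ, Fintype.card_fin, nsmul_eq_mul]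
          apply le_of_eq
          field_simp

open Filter in
/-- Riemann sums of a bounded path that takes locally constant values to the right converge. -/
lemma tendsto_riemannSum {f : ℝ≥0 → ℝ} {h : ℝ≥0} {C : ℝ} (hh : 0 < h) (hf : ∀ t, |f t| ≤ C)
    (hright : ∀ t < h, ∀ᶠ s in 𝓝[>] t, f s = f t) :
    Tendsto (riemannSum f h) atTop (𝓝 (∫ s in (0 : ℝ)..h, f s.toNNReal)) := by
  have hh' : (0 : ℝ) < h := hh
  -- The step function that evaluates `f` at the first grid point not before `s`. Its integral is
  -- the Riemann sum, and these points approach `s` from the right.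
  set F : ℕ → ℝ → ℝ := fun n s ↦ f (gridPoint h n ⌈n * s / h⌉₊)
  have hsum : ∀ᶠ n in atTop, ∫ s in (0 : ℝ)..h, F n s = riemannSum f h n := by
    filter_upwards [eventually_gt_atTop 0] with n hn
    have hn0 : (0 : ℝ) < n := by exact_mod_cast hn
    set a : ℕ → ℝ := fun k ↦ h * k / n
    have hval (k : ℕ) : ∀ s ∈ Set.Ioc (a k) (a (k + 1)), F n s = f (gridPoint h n (k + 1)) := by
      intro s hs
      have : ⌈n * s / h⌉₊ = k + 1 := by
        rw [Nat.ceil_eq_iff (by simp), Nat.add_sub_cancel]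
        constructor
        · rw [lt_div_iff₀ hh']
          have := hs.1
          simp only [a] at this
          rw [div_lt_iff₀ hn0] at this
          linarith
        · rw [div_le_iff₀ hh']
          have := hs.2
          simp only [a] at this
          rw [le_div_iff₀ hn0] at this
          linarith
      simp only [F, this]
    have hle (k : ℕ) : a k ≤ a (k + 1) := by
      simp only [a]
      gcongr
      simp
    have hint (k : ℕ) : IntervalIntegrable (F n) volume (a k) (a (k + 1)) := by
      refine IntervalIntegrable.congr (f := fun _ ↦ f (gridPoint h n (k + 1))) ?_ (by simp)
      rw [Set.uIoc_of_le (hle k)]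
      exact (fun s hs ↦ (hval k s hs).symm)
    have hstep (k : ℕ) : ∫ s in a k..a (k + 1), F n s = (h : ℝ) / n * f (gridPoint h n (k + 1)) := by
      rw [intervalIntegral.integral_congr_ae (g := fun _ ↦ f (gridPoint h n (k + 1)))]
      · rw [intervalIntegral.integral_const, smul_eq_mul]
        congr 1
        simp only [a]
        push_cast
        field_simp
        ring
      · rw [Set.uIoc_of_le (hle k)]
        exact .of_forall fun s hs ↦ hval k s hs
    have := intervalIntegral.sum_integral_adjacent_intervals (a := a) (n := n) (fun k _ ↦ hint k)
    rw [show a 0 = 0 by simp [a], show a n = h by simp only [a]; field_simp] at this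
    rw [← this, riemannSum, Finset.sum_range]
    exact Finset.sum_congr rfl fun k _ ↦ hstep k
  refine Tendsto.congr' hsum ?_
  refine intervalIntegral.tendsto_integral_filter_of_dominated_convergence (fun _ ↦ C)
    (.of_forall fun n ↦ ?_) (.of_forall fun n ↦ .of_forall fun s _ ↦ hf _) (by simp) ?_
  -- No measurability of `f` is assumed: the step function factors through `ℕ`.
  · have : Measurable fun k : ℕ ↦ f (gridPoint h n k) := measurable_from_nat
    exact (this.comp (Nat.measurable_ceil.comp (by fun_prop))).aestronglyMeasurable
  · have hne : ∀ᵐ s : ℝ, s ≠ h := by simp [ae_iff]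
    filter_upwards [hne] with s hsh hs
    rw [Set.uIoc_of_le hh'.le] at hs
    have hs0 : 0 ≤ s := hs.1.le
    have hlt : s.toNNReal < h := by
      rw [Real.toNNReal_lt_iff_lt_coe hs0]
      exact lt_of_le_of_ne hs.2 hsh
    -- The point itself is added to the neighbourhood, since `s` may be a grid point.
    have hge : ∀ᶠ t in 𝓝[≥] s.toNNReal, f t = f s.toNNReal := by
      rw [← Set.Ioi_insert, nhdsWithin_insert, eventually_sup]
      exact ⟨by simp, hright _ hlt⟩
    have htend : Tendsto (fun n : ℕ ↦ gridPoint h n ⌈n * s / h⌉₊) atTop (𝓝[≥] s.toNNReal) := by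
      refine tendsto_nhdsWithin_iff.2 ⟨?_, ?_⟩
      · rw [← NNReal.tendsto_coe, Real.coe_toNNReal _ hs0]
        have h1 := ((tendsto_nat_ceil_mul_div_atTop (R := ℝ) (a := s / h) (by positivity)).comp
          tendsto_natCast_atTop_atTop).const_mul (h : ℝ)
        rw [mul_div_cancel₀ _ hh'.ne'] at h1
        refine h1.congr fun n ↦ ?_
        simp only [Function.comp_apply, gridPoint, NNReal.coe_div, NNReal.coe_mul, NNReal.coe_natCast]
        rw [show s / h * (n : ℝ) = n * s / h by ring, mul_div_assoc (h : ℝ)]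
      · filter_upwards [eventually_gt_atTop 0] with n hn
        have hn0 : (0 : ℝ) < n := by exact_mod_cast hn
        rw [Set.mem_Ici, ← NNReal.coe_le_coe, Real.coe_toNNReal _ hs0]
        simp only [gridPoint, NNReal.coe_div, NNReal.coe_mul, NNReal.coe_natCast]
        rw [le_div_iff₀ hn0]
        have := Nat.le_ceil (n * s / h)
        rw [div_le_iff₀ hh'] at this
        linarith
    exact tendsto_nhds_of_eventually_eq (htend.eventually hge)

/-! ### Sums over paths -/

lemma sum_prod_path_eq_pow {E : Type*} [Fintype E] [DecidableEq E] (N : Matrix E E ℝ) (n : ℕ)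
    (a b : E) :
    ∑ i : Fin (n + 1) → E, (if i 0 = a ∧ i (Fin.last n) = b then
      ∏ k : Fin n, N (i k.castSucc) (i k.succ) else 0) = (N ^ n) a b := by
  induction n generalizing a with
  | zero =>
    rw [← (Equiv.funUnique (Fin 1) E).symm.sum_comp]
    simp only [Equiv.funUnique_symm_apply, uniqueElim_const, Finset.univ_eq_empty,
      Finset.prod_empty, pow_zero, Matrix.one_apply, ite_and]
    simp
  | succ n ih =>
    rw [← (Fin.consEquiv fun _ ↦ E).sum_comp, Fintype.sum_prod_type, pow_succ', Matrix.mul_apply]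
    simp only [← ih, Finset.mul_sum]
    rw [Finset.sum_comm (s := Finset.univ (α := E)), Finset.sum_comm (s := Finset.univ (α := E))]
    refine Finset.sum_congr rfl fun i _ ↦ ?_
    -- For a fixed tail `i`, the path sum keeps only the prepended state `a`, and the matrix product
    -- keeps only the intermediate state `i 0`.
    rw [Finset.sum_eq_single a, Finset.sum_eq_single (i 0)]
    · simp [Fin.consEquiv, ← Fin.succ_last, Fin.prod_univ_succ]
    · intro c _ hc
      simp [hc.symm]
    · simp
    · intro c _ hc
      simp [Fin.consEquiv, hc]
    · simp

/-! ### Exponential functionals of the Markov chain -/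

/-- The functional of a path `i₀, …, iₙ` that is `∏ exp (c (iₖ₊₁))` on the paths from `a` to `b`. -/
noncomputable def pathWeight {E : Type*} [DecidableEq E] (c : E → ℝ) (a b : E) (n : ℕ) (i : Fin (n + 1) → E) : ℝ :=
  if i 0 = a ∧ i (Fin.last n) = b then ∏ k : Fin n, Real.exp (c (i k.succ)) else 0

lemma gridPoint_zero (h : ℝ≥0) (n : ℕ) : gridPoint h n 0 = 0 := by simp [gridPoint]

lemma gridPoint_self (h : ℝ≥0) {n : ℕ} (hn : n ≠ 0) : gridPoint h n n = h := by
  have : (n : ℝ≥0) ≠ 0 := by exact_mod_cast hn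
  rw [gridPoint, mul_div_cancel_right₀ _ this]

/-- For `n ≠ 0` the times `0` and `h` are grid points, so the functional, indicator included,
depends only on the chain on the grid, whose law is known. -/
lemma indicator_mul_exp_riemannSum {Ω E : Type*} [DecidableEq E] {ε : ℝ≥0 → Ω → E}
    (h : ℝ≥0) (α : E → ℝ) (θ : ℝ) (a b : E) {n : ℕ} (hn : n ≠ 0) (ω : Ω) :
    {ω | ε 0 ω = a ∧ ε h ω = b}.indicator
        (fun ω ↦ Real.exp (θ * riemannSum (fun t ↦ α (ε t ω)) h n)) ω =
      pathWeight (fun e ↦ (n : ℝ)⁻¹ * (h * (θ * α e))) a b n (fun k ↦ ε (gridPoint h n k) ω) := by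
  classical
  rw [Set.indicator_apply, pathWeight]
  simp only [Set.mem_ofPred_eq, Fin.val_zero, Fin.val_last, gridPoint_zero, gridPoint_self h hn,
    riemannSum, Finset.mul_sum, Real.exp_sum, Fin.val_succ]
  congr 2
  funext k
  congr 1
  ring

section

variable {Ω E : Type*} [MeasurableSpace Ω] {P : Measure Ω} [Fintype E] [DecidableEq E]
  [MeasurableSpace E]
  {T h : ℝ≥0} {Q : Matrix E E ℝ} {ε : ℝ≥0 → Ω → E} {W : ℝ≥0 → Ω → ℝ}

open Filter in
lemma IsMarkovChainOn.tendsto_riemannSum (hε : IsMarkovChainOn T Q ε P) (hh : 0 < h) (hT : h ≤ T)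
    (α : E → ℝ) : ∀ᵐ ω ∂P, Tendsto (riemannSum (fun t ↦ α (ε t ω)) h) atTop
      (𝓝 (∫ s in (0 : ℝ)..h, α (ε s.toNNReal ω))) := by
  filter_upwards [hε.right_continuous] with ω hω
  refine HiddenChain.tendsto_riemannSum hh (C := ∑ e, |α e|)
    (fun t ↦ Finset.single_le_sum (f := fun e ↦ |α e|) (fun e _ ↦ abs_nonneg _) (Finset.mem_univ _))
    fun t ht ↦ ?_
  filter_upwards [hω t (ht.trans_le hT)] with s hs
  rw [hs]

variable [MeasurableSingletonClass E]

lemma measurable_pathWeight (c : E → ℝ) (a b : E) (n : ℕ) : Measurable (pathWeight c a b n) :=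
  measurable_of_finite _

/-- The weight of step `k` depends on its target state only, so it rescales the columns of the
transition matrix: multiplication on the right by a diagonal exponential. The sum over paths is then
a matrix power. -/
lemma IsMarkovChainOn.integral_pathWeight [IsProbabilityMeasure P] (hε : IsMarkovChainOn T Q ε P)
    (hT : h ≤ T) (c : E → ℝ) (a b : E) {n : ℕ} (hn : n ≠ 0) :
    ∫ ω, pathWeight (fun e ↦ (n : ℝ)⁻¹ * c e) a b n (fun k ↦ ε (gridPoint h n k) ω) ∂P =
      P.real {ω | ε 0 ω = a} * ((NormedSpace.exp ((n : ℝ)⁻¹ • ((h : ℝ) • Q)) *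
        NormedSpace.exp ((n : ℝ)⁻¹ • Matrix.diagonal c)) ^ n) a b := by
  have hle (k : Fin (n + 1)) : gridPoint h n k ≤ T :=
    (gridPoint_le h (Nat.lt_succ_iff.1 k.2)).trans hT
  have hm : Measurable fun ω (k : Fin (n + 1)) ↦ ε (gridPoint h n k) ω :=
    measurable_pi_lambda _ fun k ↦ hε.measurable _ (hle k)
  rw [← integral_map (f := pathWeight (fun e ↦ (n : ℝ)⁻¹ * c e) a b n) hm.aemeasurable
    (measurable_pathWeight _ _ _ _).aestronglyMeasurable,
    integral_fintype (.of_finite), ← sum_prod_path_eq_pow, Finset.mul_sum]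
  refine Finset.sum_congr rfl fun i _ ↦ ?_
  rw [map_measureReal_apply hm (measurableSet_singleton i), pathWeight]
  split_ifs with hi
  · have hmono : Monotone fun k : Fin (n + 1) ↦ gridPoint h n k := by
      intro k l hkl
      simp only [gridPoint]
      gcongr
      exact hkl
    have hfd := hε.finite_dimensional n (fun k ↦ gridPoint h n k) i hmono hle
    have hset : (fun ω (k : Fin (n + 1)) ↦ ε (gridPoint h n k) ω) ⁻¹' {i} =
        {ω | ∀ k : Fin (n + 1), ε (gridPoint h n k) ω = i k} := by
      ext ω
      simp [funext_iff]
    have hstep (k : Fin n) : ((gridPoint h n k.succ - gridPoint h n k.castSucc : ℝ≥0) : ℝ) =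
        (n : ℝ)⁻¹ * h := by
      rw [NNReal.coe_sub (hmono (Fin.castSucc_lt_succ).le)]
      simp only [gridPoint, Fin.val_succ, Fin.val_castSucc, NNReal.coe_div, NNReal.coe_mul,
        NNReal.coe_natCast]
      push_cast
      ring
    rw [hset, hfd, smul_eq_mul, mul_assoc, ← Finset.prod_mul_distrib]
    simp only [Fin.val_zero, gridPoint_zero, hi.1]
    congr 1
    refine Finset.prod_congr rfl fun k _ ↦ ?_
    rw [transitionMatrix, hstep, ← Matrix.diagonal_smul, Matrix.exp_diagonal, Matrix.mul_diagonal,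
      Pi.coe_exp, smul_smul, Real.exp_eq_exp_ℝ]
    rfl
  · simp

lemma IsMarkovChainOn.measurable_riemannSum (hε : IsMarkovChainOn T Q ε P) (hT : h ≤ T)
    (α : E → ℝ) (n : ℕ) : Measurable fun ω ↦ riemannSum (fun t ↦ α (ε t ω)) h n :=
  Finset.measurable_fun_sum _ fun k _ ↦ ((measurable_of_finite α).comp
    (hε.measurable _ ((gridPoint_le h k.2).trans hT))).const_mul _

/-- The chain is only measurable at each fixed time, so measurability of the time integral comes
from its Riemann sums. -/
lemma IsMarkovChainOn.aemeasurable_integral (hε : IsMarkovChainOn T Q ε P) (hh : 0 < h) (hT : h ≤ T)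
    (α : E → ℝ) : AEMeasurable (fun ω ↦ ∫ s in (0 : ℝ)..h, α (ε s.toNNReal ω)) P :=
  aemeasurable_of_tendsto_metrizable_ae' (fun n ↦ (hε.measurable_riemannSum hT α n).aemeasurable)
    (hε.tendsto_riemannSum hh hT α)

lemma IsMarkovChainOn.measurableSet_endpoints (hε : IsMarkovChainOn T Q ε P) (hT : h ≤ T) (a b : E) :
    MeasurableSet {ω | ε 0 ω = a ∧ ε h ω = b} :=
  (hε.measurable 0 zero_le measurableSet_eq).inter (hε.measurable h hT measurableSet_eq)

lemma IsBrownianOn.hasLaw_eval (hW : IsBrownianOn T W P) (hT : h ≤ T) :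
    HasLaw (W h) (gaussianReal 0 h) P :=
  (BrownianReal.measurePreserving_eval_projectiveFamily ⟨h, by simp⟩).hasLaw.comp
    (hW.hasLaw {h} (by simpa using hT))

lemma aemeasurable_observation (hε : IsMarkovChainOn T Q ε P) (hW : IsBrownianOn T W P)
    (hh : 0 < h) (hT : h ≤ T) (α : E → ℝ) (σ : ℝ) : AEMeasurable (observation α σ ε W h) P :=
  (hε.aemeasurable_integral hh hT α).add ((hW.hasLaw_eval hT).aemeasurable.const_mul σ)

open Filter in
/-- The exponential moments of the observation on the event that the chain runs from `a` to `b`. -/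
theorem setIntegral_exp_mul_observation [IsProbabilityMeasure P]
    (hε : IsMarkovChainOn T Q ε P) (hW : IsBrownianOn T W P)
    (hindep : IndepFun (fun ω (t : Set.Iic T) ↦ ε t ω) (fun ω (t : Set.Iic T) ↦ W t ω) P)
    (hh : 0 < h) (hT : h ≤ T) (α : E → ℝ) (σ θ : ℝ) (a b : E) :
    IntegrableOn (fun ω ↦ Real.exp (θ * observation α σ ε W h ω)) {ω | ε 0 ω = a ∧ ε h ω = b} P ∧
    ∫ ω in {ω | ε 0 ω = a ∧ ε h ω = b}, Real.exp (θ * observation α σ ε W h ω) ∂P =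
      P.real {ω | ε 0 ω = a} *
        NormedSpace.exp ((h : ℝ) • (Q + Matrix.diagonal fun e ↦ θ * α e)) a b *
        Real.exp ((θ * σ) ^ 2 * h / 2) := by
  set A := {ω | ε 0 ω = a ∧ ε h ω = b}
  have hA : MeasurableSet A := hε.measurableSet_endpoints hT a b
  set C := ∑ e, |α e|
  have hC : 0 ≤ C := Finset.sum_nonneg fun e _ ↦ abs_nonneg _
  have hbd (e : E) : |α e| ≤ C :=
    Finset.single_le_sum (f := fun e ↦ |α e|) (fun e _ ↦ abs_nonneg _) (Finset.mem_univ _)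
  have hlaw := hW.hasLaw_eval hT
  have hWexp : Integrable (fun ω ↦ Real.exp (θ * σ * W h ω)) P := by
    have := integrable_exp_mul_gaussianReal (μ := 0) (v := h) (θ * σ)
    rw [← hlaw.map_eq] at this
    exact this.comp_aemeasurable hlaw.aemeasurable
  have hWint : ∫ ω, Real.exp (θ * σ * W h ω) ∂P = Real.exp ((θ * σ) ^ 2 * h / 2) := by
    have := mgf_gaussianReal hlaw.map_eq (θ * σ)
    rw [mgf] at this
    rw [this]
    congr 1
    ring
  set G : ℕ → Ω → ℝ := fun n ω ↦
    A.indicator (fun ω ↦ Real.exp (θ * riemannSum (fun t ↦ α (ε t ω)) h n)) ω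
  have hGm (n : ℕ) : Measurable (G n) :=
    (((hε.measurable_riemannSum hT α n).const_mul θ).exp).indicator hA
  have hGbd (n : ℕ) (ω : Ω) : |G n ω| ≤ Real.exp (|θ| * (h * C)) := by
    simp only [G, Set.indicator_apply]
    split_ifs
    · rw [Real.abs_exp]
      refine Real.exp_le_exp.2 ((le_abs_self _).trans ?_)
      rw [abs_mul]
      gcongr
      exact abs_riemannSum_le hC (fun t ↦ hbd _) h n
    · simpa using (Real.exp_pos _).le
  have hGint (n : ℕ) (hn : n ≠ 0) : ∫ ω, G n ω * Real.exp (θ * σ * W h ω) ∂P =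
      P.real {ω | ε 0 ω = a} * ((NormedSpace.exp ((n : ℝ)⁻¹ • ((h : ℝ) • Q)) *
        NormedSpace.exp ((n : ℝ)⁻¹ • Matrix.diagonal fun e ↦ h * (θ * α e))) ^ n) a b *
        Real.exp ((θ * σ) ^ 2 * h / 2) := by
    have hG : G n = fun ω ↦ pathWeight (fun e ↦ (n : ℝ)⁻¹ * (h * (θ * α e))) a b n
        (fun k ↦ ε (gridPoint h n k) ω) :=
      funext fun ω ↦ indicator_mul_exp_riemannSum h α θ a b hn ω
    have hle (k : Fin (n + 1)) : gridPoint h n k ≤ T :=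
      (gridPoint_le h (Nat.lt_succ_iff.1 k.2)).trans hT
    -- Independence is used for the discretised functional, a measurable function of finitely many
    -- values of the chain.
    have hind : IndepFun (G n) (fun ω ↦ Real.exp (θ * σ * W h ω)) P := by
      rw [hG]
      exact hindep.comp (φ := fun p ↦ pathWeight (fun e ↦ (n : ℝ)⁻¹ * (h * (θ * α e))) a b n
          (fun k ↦ p ⟨gridPoint h n k, hle k⟩)) (ψ := fun p ↦ Real.exp (θ * σ * p ⟨h, hT⟩))
        ((measurable_pathWeight _ _ _ _).comp (measurable_pi_lambda _ fun k ↦ measurable_pi_apply _))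
        (((measurable_pi_apply _).const_mul _).exp)
    rw [hind.integral_fun_mul_eq_mul_integral (hGm n).aestronglyMeasurable hWexp.1, hWint, hG,
      hε.integral_pathWeight hT _ a b hn]
  set X : Ω → ℝ := A.indicator fun ω ↦ Real.exp (θ * observation α σ ε W h ω)
  have hlim : ∀ᵐ ω ∂P, Tendsto (fun n ↦ G n ω * Real.exp (θ * σ * W h ω)) atTop (𝓝 (X ω)) := by
    filter_upwards [hε.tendsto_riemannSum hh hT α] with ω hω
    simp only [G, X, Set.indicator_apply]
    split_ifs
    · rw [observation, mul_add, Real.exp_add, ← mul_assoc θ σ]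
      exact (((Real.continuous_exp.tendsto _).comp (hω.const_mul θ))).mul_const _
    · simp
  have hdom : Integrable (fun ω ↦ Real.exp (|θ| * (h * C)) * Real.exp (θ * σ * W h ω)) P :=
    hWexp.const_mul _
  have hGW (n : ℕ) (ω : Ω) : ‖G n ω * Real.exp (θ * σ * W h ω)‖ ≤
      Real.exp (|θ| * (h * C)) * Real.exp (θ * σ * W h ω) := by
    rw [norm_mul, Real.norm_eq_abs, Real.norm_eq_abs, Real.abs_exp]
    gcongr
    exact hGbd n ω
  have hGWm (n : ℕ) : AEStronglyMeasurable (fun ω ↦ G n ω * Real.exp (θ * σ * W h ω)) P :=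
    (hGm n).aestronglyMeasurable.mul hWexp.1
  have hXint : Integrable X P := by
    refine hdom.mono' (aestronglyMeasurable_of_tendsto_ae atTop hGWm hlim) ?_
    filter_upwards [hlim] with ω hω
    exact le_of_tendsto hω.norm (.of_forall fun n ↦ hGW n ω)
  refine ⟨(integrable_indicator_iff hA).1 hXint, ?_⟩
  rw [← integral_indicator hA]
  have h1 := tendsto_integral_of_dominated_convergence _ hGWm hdom
    (fun n ↦ .of_forall (hGW n)) hlim
  refine tendsto_nhds_unique h1 ?_
  have : Nonempty E := ⟨a⟩
  have h2 := ((tendsto_matrix_exp_mul_exp_pow ((h : ℝ) • Q) (Matrix.diagonal fun e ↦ h * (θ * α e))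
    a b).const_mul (P.real {ω | ε 0 ω = a})).mul_const (Real.exp ((θ * σ) ^ 2 * h / 2))
  have h3 : (h : ℝ) • (Q + Matrix.diagonal fun e ↦ θ * α e) =
      (h : ℝ) • Q + Matrix.diagonal fun e ↦ h * (θ * α e) := by
    rw [smul_add, ← Matrix.diagonal_smul]
    rfl
  rw [h3]
  refine h2.congr' ?_
  filter_upwards [eventually_ne_atTop 0] with n hn
  rw [hGint n hn]

end

/-! ### Densities and exponential moments -/

/-- Two finite measures on `ℝ` with the same finite exponential moments are equal. -/
lemma ext_of_integral_exp_mul {μ ν : Measure ℝ} [IsFiniteMeasure μ] [IsFiniteMeasure ν]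
    (hμ : ∀ θ : ℝ, Integrable (fun x ↦ Real.exp (θ * x)) μ)
    (h : ∀ θ : ℝ, ∫ x, Real.exp (θ * x) ∂μ = ∫ x, Real.exp (θ * x) ∂ν) : μ = ν := by
  have hset : integrableExpSet id μ = Set.univ := Set.eq_univ_of_forall hμ
  -- A divergent integral has the default value `0`, so equal moments transfer integrability to `ν`
  -- only when the zero measure is kept apart; `θ = 0` compares the total masses.
  have hzero : μ = 0 ↔ ν = 0 := by
    have := h 0
    simp only [zero_mul, Real.exp_zero, integral_const, smul_eq_mul, mul_one] at this
    rw [← Measure.measure_univ_eq_zero, ← Measure.measure_univ_eq_zero, ← measureReal_eq_zero_iff,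
      ← measureReal_eq_zero_iff, this]
  -- Analytic continuation: the strip of convergence is the whole plane, including the imaginary
  -- axis of the characteristic function.
  refine Measure.ext_of_complexMGF_id_eq (funext fun z ↦ ?_)
  exact eqOn_complexMGF_of_mgf' (funext h) hzero (by simp [show integrableExpSet (fun x ↦ x) μ = Set.univ from hset])

lemma isDensityOf_of_integral_exp_mul {Ω : Type*} [MeasurableSpace Ω] {μ : Measure Ω}
    [IsFiniteMeasure μ] {g : ℝ → ℝ} {X : Ω → ℝ} (hX : AEMeasurable X μ) (hg : Measurable g)
    (hg0 : ∀ z, 0 ≤ g z) (hXint : ∀ θ : ℝ, Integrable (fun ω ↦ Real.exp (θ * X ω)) μ)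
    (hgint : ∀ θ : ℝ, Integrable fun z ↦ Real.exp (θ * z) * g z)
    (h : ∀ θ : ℝ, ∫ ω, Real.exp (θ * X ω) ∂μ = ∫ z, Real.exp (θ * z) * g z) :
    IsDensityOf g X μ := by
  refine ⟨hg, hg0, hX, ?_⟩
  have hfin : IsFiniteMeasure (volume.withDensity fun z ↦ ENNReal.ofReal (g z)) := by
    have : Integrable g := by simpa using hgint 0
    exact isFiniteMeasure_withDensity_ofReal this.2
  have hcont (θ : ℝ) : Continuous fun x : ℝ ↦ Real.exp (θ * x) := by fun_prop
  refine ext_of_integral_exp_mul (fun θ ↦ ?_) fun θ ↦ ?_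
  · exact (integrable_map_measure (hcont θ).aestronglyMeasurable hX).2 (hXint θ)
  · rw [integral_map hX (hcont θ).aestronglyMeasurable, h θ,
      integral_withDensity_eq_integral_toReal_smul hg.ennreal_ofReal (by simp)]
    refine integral_congr_ae (.of_forall fun z ↦ ?_)
    simp [ENNReal.toReal_ofReal (hg0 z), mul_comm]

lemma integral_cond {Ω : Type*} [MeasurableSpace Ω] (P : Measure Ω) (A : Set Ω) (f : Ω → ℝ) :
    ∫ ω, f ω ∂P[|A] = (P.real A)⁻¹ * ∫ ω in A, f ω ∂P := by
  rw [ProbabilityTheory.cond, integral_smul_measure, smul_eq_mul, ENNReal.toReal_inv]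
  rfl

/-! ### Gaussian mixtures -/

lemma normalDensity_sub_eq {s : ℝ} (hs : 0 < s) (m z : ℝ) :
    normalDensity s (z - m) = gaussianPDFReal m (s.toNNReal ^ 2) z := by
  rw [normalDensity, gaussianPDFReal]
  have hsq : √(2 * Real.pi * s ^ 2) = √(2 * Real.pi) * s := by
    rw [Real.sqrt_mul (by positivity), Real.sqrt_sq hs.le]
  simp only [NNReal.coe_pow, Real.coe_toNNReal _ hs.le, hsq, one_div]
  congr 2
  field_simp

lemma normalDensity_nonneg {s : ℝ} (hs : 0 < s) (x : ℝ) : 0 ≤ normalDensity s x := by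
  rw [normalDensity]; positivity

@[fun_prop]
lemma continuous_normalDensity (s : ℝ) : Continuous (normalDensity s) := by
  unfold normalDensity; fun_prop

lemma integrable_exp_mul_normalDensity {s : ℝ} (hs : 0 < s) (θ m : ℝ) :
    Integrable fun z ↦ Real.exp (θ * z) * normalDensity s (z - m) := by
  have hv : s.toNNReal ^ 2 ≠ 0 := pow_ne_zero 2 (Real.toNNReal_pos.2 hs).ne'
  have := integrable_exp_mul_gaussianReal (μ := m) (v := s.toNNReal ^ 2) θ
  rw [gaussianReal_of_var_ne_zero _ hv, gaussianPDF_def, integrable_withDensity_iff_integrable_smul'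
    (measurable_gaussianPDFReal _ _).ennreal_ofReal (by simp)] at this
  refine this.congr (.of_forall fun z ↦ ?_)
  simp only [normalDensity_sub_eq hs, ENNReal.toReal_ofReal (gaussianPDFReal_nonneg _ _ _), smul_eq_mul,
    mul_comm]

lemma integral_exp_mul_normalDensity {s : ℝ} (hs : 0 < s) (θ m : ℝ) :
    ∫ z, Real.exp (θ * z) * normalDensity s (z - m) = Real.exp (θ * m) * Real.exp (θ ^ 2 * s ^ 2 / 2) := by
  have hv : s.toNNReal ^ 2 ≠ 0 := pow_ne_zero 2 (Real.toNNReal_pos.2 hs).ne'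
  have := congrFun (mgf_fun_id_gaussianReal (μ := m) (v := s.toNNReal ^ 2)) θ
  rw [mgf, integral_gaussianReal_eq_integral_smul hv] at this
  rw [← Real.exp_add]
  simp only [normalDensity_sub_eq hs]
  simp only [smul_eq_mul, mul_comm (gaussianPDFReal _ _ _), NNReal.coe_pow,
    Real.coe_toNNReal _ hs.le] at this
  rw [this]
  congr 1
  ring

/-- The exponential moments of a Gaussian mixture `∫₀ʰ φ_s(z - m(u)) k(u) du`. -/
lemma integral_exp_mul_mixture {s h : ℝ} (hs : 0 < s) (hh : 0 ≤ h) {m k : ℝ → ℝ} (hm : Continuous m)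
    (hk : Continuous k) (θ : ℝ) :
    Integrable (fun z ↦ Real.exp (θ * z) * ∫ u in (0 : ℝ)..h, normalDensity s (z - m u) * k u) ∧
    ∫ z, Real.exp (θ * z) * ∫ u in (0 : ℝ)..h, normalDensity s (z - m u) * k u =
      Real.exp (θ ^ 2 * s ^ 2 / 2) * ∫ u in (0 : ℝ)..h, Real.exp (θ * m u) * k u := by
  set μ : Measure ℝ := volume.restrict (Set.Ioc 0 h)
  set f : ℝ × ℝ → ℝ := fun p ↦ Real.exp (θ * p.1) * normalDensity s (p.1 - m p.2) * k p.2
  have hf : Continuous f := by simp only [f]; fun_prop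
  have hnorm (u z : ℝ) : ‖f (z, u)‖ = Real.exp (θ * z) * normalDensity s (z - m u) * |k u| := by
    simp only [f, norm_mul, Real.norm_eq_abs, Real.abs_exp, abs_of_nonneg (normalDensity_nonneg hs _)]
  have hint : Integrable f (volume.prod μ) := by
    refine (integrable_prod_iff' hf.aestronglyMeasurable).2 ⟨.of_forall fun u ↦ ?_, ?_⟩
    · exact (integrable_exp_mul_normalDensity hs θ (m u)).mul_const (k u)
    · simp only [hnorm, integral_mul_const, integral_exp_mul_normalDensity hs]
      exact (by fun_prop : Continuous fun u ↦ Real.exp (θ * m u) * Real.exp (θ ^ 2 * s ^ 2 / 2) *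
        |k u|).integrableOn_Ioc
  have heq (z : ℝ) : Real.exp (θ * z) * ∫ u in (0 : ℝ)..h, normalDensity s (z - m u) * k u =
      ∫ u, f (z, u) ∂μ := by
    rw [intervalIntegral.integral_of_le hh, ← integral_const_mul]
    simp only [f, mul_assoc, μ]
  simp only [heq]
  refine ⟨hint.integral_prod_left, ?_⟩
  rw [integral_integral_swap hint, intervalIntegral.integral_of_le hh, ← integral_const_mul]
  refine integral_congr_ae (.of_forall fun u ↦ ?_)
  simp only [f, integral_mul_const, integral_exp_mul_normalDensity hs]
  ring

/-! ### The convolution terms -/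

section

variable {α : Fin 2 → ℝ} {σ h : ℝ} {κ k : ℝ → ℝ}

lemma halfGap_ne_zero (hα : α 0 ≠ α 1) : halfGap α ≠ 0 := by
  rw [halfGap]
  have := sub_ne_zero.2 hα
  positivity

/-- `k` is a continuous version of the kernel `κ`. They may differ at `y = h`, where the formulas
for `p̃` and `q̃₊` divide by zero, but this concerns a single point `x`. -/
lemma intervalIntegrable_convIntegrand (hα : α 0 ≠ α 1) (hh : 0 < h) (hk : Continuous k)
    (hκ : ∀ y ∈ Set.Ico (-h) h, κ y = k y) (z : ℝ) :
    IntervalIntegrable (convIntegrand κ α σ h z) volume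
      (h * (meanDrift α - |halfGap α|)) (h * (meanDrift α + |halfGap α|)) := by
  have hb := halfGap_ne_zero hα
  have hc : Continuous (convIntegrand k α σ h z) := by
    unfold convIntegrand; fun_prop
  refine (hc.intervalIntegrable _ _).congr_ae ?_
  have hne : ∀ᵐ x : ℝ, x ≠ meanDrift α * h + halfGap α * h := by simp [ae_iff]
  refine (ae_restrict_iff' measurableSet_uIoc).2 ?_
  filter_upwards [hne] with x hx hmem
  have hab : 0 < |halfGap α| := abs_pos.2 hb
  rw [Set.uIoc_of_le (by nlinarith)] at hmem
  rw [convIntegrand, convIntegrand, hκ]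
  have habs : |(x - meanDrift α * h) / halfGap α| ≤ h := by
    rw [abs_div, div_le_iff₀ hab, abs_le]
    constructor <;> nlinarith [hmem.1, hmem.2]
  refine ⟨(abs_le.1 habs).1, lt_of_le_of_ne (abs_le.1 habs).2 fun h' ↦ hx ?_⟩
  rw [div_eq_iff hb] at h'
  linarith

/-- The convolution term as an integral over the time `u` spent in the first state. -/
lemma convTerm_eq (hα : α 0 ≠ α 1) (hh : 0 < h) (hκ : ∀ y ∈ Set.Ico (-h) h, κ y = k y) (z : ℝ) :
    convTerm κ α σ h z = ∫ u in (0 : ℝ)..h,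
      normalDensity (σ * √h) (z - (α 0 * u + α 1 * (h - u))) * (2 * k (2 * u - h)) := by
  have hb := halfGap_ne_zero hα
  -- The substitution `x = α 0 u + α 1 (h - u)` has derivative `2 b₁`, whence the factor `2`. For
  -- `b₁ < 0` it reverses orientation, which `|b₁|` compensates.
  have hpt (u : ℝ) : convIntegrand κ α σ h z (h * (meanDrift α - halfGap α) + 2 * halfGap α * u) =
      normalDensity (σ * √h) (z - (α 0 * u + α 1 * (h - u))) * κ (2 * u - h) := by
    rw [convIntegrand]
    congr 2
    · rw [meanDrift, halfGap]; ring
    · rw [div_eq_iff hb]; ring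
  have hsub := intervalIntegral.integral_comp_add_mul (a := 0) (b := h) (convIntegrand κ α σ h z)
    (mul_ne_zero two_ne_zero hb) (h * (meanDrift α - halfGap α))
  rw [show h * (meanDrift α - halfGap α) + 2 * halfGap α * 0 = h * (meanDrift α - halfGap α) by ring,
    show h * (meanDrift α - halfGap α) + 2 * halfGap α * h = h * (meanDrift α + halfGap α) by ring,
    smul_eq_mul, eq_inv_mul_iff_mul_eq₀ (mul_ne_zero two_ne_zero hb)] at hsub
  have hone : convTerm κ α σ h z = 2 * ∫ u in (0 : ℝ)..h,
      convIntegrand κ α σ h z (h * (meanDrift α - halfGap α) + 2 * halfGap α * u) := by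
    rw [convTerm]
    rcases hb.lt_or_gt with hneg | hpos
    · rw [abs_of_neg hneg, intervalIntegral.integral_symm, sub_neg_eq_add, ← sub_eq_add_neg, ← hsub]
      field_simp
    · rw [abs_of_pos hpos, ← hsub]
      field_simp
  rw [hone, ← intervalIntegral.integral_const_mul]
  refine intervalIntegral.integral_congr_ae ?_
  have hne : ∀ᵐ u : ℝ, u ≠ h := by simp [ae_iff]
  filter_upwards [hne] with u hu hmem
  rw [Set.uIoc_of_le hh.le] at hmem
  rw [hpt, hκ]
  · ring
  · have := lt_of_le_of_ne hmem.2 hu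
    constructor <;> linarith [hmem.1]

lemma atomTerm_eq (z : ℝ) : atomTerm α σ h z = normalDensity (σ * √h) (z - α 0 * h) := by
  rw [atomTerm, halfGap, meanDrift]
  congr 2
  ring

lemma measurable_convTerm (hα : α 0 ≠ α 1) (hh : 0 < h) (hk : Continuous k)
    (hκ : ∀ y ∈ Set.Ico (-h) h, κ y = k y) : Measurable (convTerm κ α σ h) := by
  rw [funext (convTerm_eq hα hh hκ)]
  refine Continuous.measurable (intervalIntegral.continuous_parametric_intervalIntegral_of_continuous' ?_ _ _)
  simp only [Function.uncurry_def]
  fun_prop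

lemma convTerm_nonneg (hα : α 0 ≠ α 1) (hσ : 0 < σ) (hh : 0 < h)
    (hκ : ∀ y ∈ Set.Ico (-h) h, κ y = k y) (hk0 : ∀ y ∈ Set.Icc (-h) h, 0 ≤ k y) (z : ℝ) :
    0 ≤ convTerm κ α σ h z := by
  rw [convTerm_eq hα hh hκ]
  refine intervalIntegral.integral_nonneg hh.le fun u hu ↦ mul_nonneg
    (normalDensity_nonneg (by positivity) _) (mul_nonneg zero_le_two (hk0 _ ?_))
  constructor <;> linarith [hu.1, hu.2]

lemma convTerm_add_const_mul {κ' k' : ℝ → ℝ} (hα : α 0 ≠ α 1) (hh : 0 < h) (hk : Continuous k)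
    (hk' : Continuous k') (hκ : ∀ y ∈ Set.Ico (-h) h, κ y = k y)
    (hκ' : ∀ y ∈ Set.Ico (-h) h, κ' y = k' y) (c z : ℝ) :
    convTerm (fun x ↦ κ x + c * κ' x) α σ h z = convTerm κ α σ h z + c * convTerm κ' α σ h z := by
  have h1 := intervalIntegrable_convIntegrand (σ := σ) hα hh hk hκ z
  have h2 := intervalIntegrable_convIntegrand (σ := σ) hα hh hk' hκ' z
  have : convIntegrand (fun x ↦ κ x + c * κ' x) α σ h z =
      fun x ↦ convIntegrand κ α σ h z x + c * convIntegrand κ' α σ h z x := by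
    funext x
    simp only [convIntegrand]
    ring
  rw [convTerm, this, intervalIntegral.integral_add h1 (h2.const_mul c),
    intervalIntegral.integral_const_mul, convTerm, convTerm]
  ring

end

/-! ### The kernels -/

section

variable {l₁ l₂ h : ℝ}

/-- The kernel `q̃_{h,+,1}` without its removable singularity at `h`. -/
noncomputable def returnKernel (l₁ l₂ h x : ℝ) : ℝ :=
  l₁ / 2 * Real.exp ((l₁ - l₂) / 2 * (h - x)) *
    (l₂ * ((h + x) / 2) * besselSeries 1 (l₁ * l₂ * (h ^ 2 - x ^ 2) / 4))

/-- The kernel `q̃_{h,-,1}` in terms of the entire Bessel series. -/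
noncomputable def switchKernel (l₁ l₂ h x : ℝ) : ℝ :=
  1 / 2 * Real.exp ((l₁ - l₂) / 2 * (h - x)) * besselSeries 0 (l₁ * l₂ * (h ^ 2 - x ^ 2) / 4)

lemma continuous_returnKernel : Continuous (returnKernel l₁ l₂ h) := by
  unfold returnKernel; fun_prop

lemma continuous_switchKernel : Continuous (switchKernel l₁ l₂ h) := by
  unfold switchKernel; fun_prop

lemma bessel_arg_nonneg (hl₁ : 0 < l₁) (hl₂ : 0 < l₂) {x : ℝ} (hx : x ∈ Set.Icc (-h) h) :
    0 ≤ l₁ * l₂ * (h ^ 2 - x ^ 2) / 4 := by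
  have : 0 ≤ h ^ 2 - x ^ 2 := by nlinarith [hx.1, hx.2]
  positivity

lemma returnKernel_nonneg (hl₁ : 0 < l₁) (hl₂ : 0 < l₂) : ∀ x ∈ Set.Icc (-h) h, 0 ≤ returnKernel l₁ l₂ h x := by
  intro x hx
  have h1 := besselSeries_nonneg 1 (bessel_arg_nonneg hl₁ hl₂ hx)
  have h2 : 0 ≤ h + x := by linarith [hx.1]
  rw [returnKernel]
  positivity

lemma switchKernel_nonneg (hl₁ : 0 < l₁) (hl₂ : 0 < l₂) : ∀ x ∈ Set.Icc (-h) h, 0 ≤ switchKernel l₁ l₂ h x := by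
  intro x hx
  have h1 := besselSeries_nonneg 0 (bessel_arg_nonneg hl₁ hl₂ hx)
  rw [switchKernel]
  positivity

lemma kernelQPlus_eq (hl₁ : 0 < l₁) (hl₂ : 0 < l₂) :
    ∀ x ∈ Set.Ico (-h) h, kernelQPlus l₁ l₂ h x = returnKernel l₁ l₂ h x := by
  intro x hx
  have harg := bessel_arg_nonneg hl₁ hl₂ (Set.Ico_subset_Icc_self hx)
  have h1 : 0 ≤ h + x := by linarith [hx.1]
  have h2 : 0 < h - x := by linarith [hx.2]
  -- The root in front of `B₁` cancels the factor `h - x`, which removes the singularity.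
  have hsqrt : √(((h + x) * l₂) / ((h - x) * l₁)) * √(l₁ * l₂ * (h ^ 2 - x ^ 2) / 4) =
      l₂ * ((h + x) / 2) := by
    rw [← Real.sqrt_mul (by positivity), ← Real.sqrt_sq (by positivity : 0 ≤ l₂ * ((h + x) / 2))]
    congr 1
    field_simp
    ring
  rw [kernelQPlus, returnKernel, show l₁ * l₂ * (h ^ 2 - x ^ 2) = 4 * (l₁ * l₂ * (h ^ 2 - x ^ 2) / 4) by ring,
    besselB1_sqrt harg, ← hsqrt]
  rw [show 4 * (l₁ * l₂ * (h ^ 2 - x ^ 2) / 4) = l₁ * l₂ * (h ^ 2 - x ^ 2) by ring]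
  ring

lemma kernelQMinus_eq (hl₁ : 0 < l₁) (hl₂ : 0 < l₂) :
    ∀ x ∈ Set.Ico (-h) h, kernelQMinus l₁ l₂ h x = switchKernel l₁ l₂ h x := by
  intro x hx
  have harg := bessel_arg_nonneg hl₁ hl₂ (Set.Ico_subset_Icc_self hx)
  rw [kernelQMinus, switchKernel, ← besselB0_sqrt harg]
  congr 3
  ring

/-- The decomposition according to the state at time `h`. -/
lemma kernelP_eq_add : kernelP l₁ l₂ h = fun x ↦ kernelQPlus l₁ l₂ h x + l₁ * kernelQMinus l₁ l₂ h x := by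
  funext x
  rw [kernelP, kernelQPlus, kernelQMinus]
  ring

end

/-! ### Exponential moments of the explicit densities -/

section

variable {l₁ l₂ : ℝ} {α : Fin 2 → ℝ} {σ h : ℝ}

lemma tilted_twoStateIntensity (l₁ l₂ θ : ℝ) (α : Fin 2 → ℝ) :
    (twoStateIntensity l₁ l₂ + Matrix.diagonal fun e ↦ θ * α e) =
      !![-l₁ + θ * α 0, l₁; l₂, -l₂ + θ * α 1] := by
  ext i j
  fin_cases i <;> fin_cases j <;> simp [twoStateIntensity]

/-- The transition probabilities of the two-state chain out of the first state. -/
lemma exp_smul_twoStateIntensity (hl₁ : 0 < l₁) (hl₂ : 0 < l₂) (h : ℝ) :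
    NormedSpace.exp (h • twoStateIntensity l₁ l₂) 0 0 =
        (l₂ + l₁ * Real.exp (-(l₁ + l₂) * h)) / (l₁ + l₂) ∧
      NormedSpace.exp (h • twoStateIntensity l₁ l₂) 0 1 =
        l₁ * (1 - Real.exp (-(l₁ + l₂) * h)) / (l₁ + l₂) := by
  have hne : l₁ + l₂ ≠ 0 := by positivity
  have hE (t : ℝ) : HasDerivAt (fun t ↦ Real.exp (-(l₁ + l₂) * t))
      (Real.exp (-(l₁ + l₂) * t) * -(l₁ + l₂)) t := by
    simpa using ((hasDerivAt_id t).const_mul (-(l₁ + l₂))).exp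
  refine exp_smul_matrix_fin_two_row (f := fun t ↦ (l₂ + l₁ * Real.exp (-(l₁ + l₂) * t)) / (l₁ + l₂))
    (g := fun t ↦ l₁ * (1 - Real.exp (-(l₁ + l₂) * t)) / (l₁ + l₂)) (fun t ↦ ?_) (fun t ↦ ?_) ?_ ?_ h
  · convert! (((hE t).const_mul l₁).const_add l₂).div_const (l₁ + l₂) using 1
    field_simp
    ring
  · convert! (((hE t).const_sub 1).const_mul l₁).div_const (l₁ + l₂) using 1
    field_simp
    ring
  · simp only [mul_zero, Real.exp_zero, mul_one]
    field_simp
    ring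
  · simp

/-- The exponential moments of the unnormalised density on the event `ε_h = 1`. -/
lemma integral_exp_mul_return (hl₁ : 0 < l₁) (hl₂ : 0 < l₂) (hα : α 0 ≠ α 1) (hσ : 0 < σ)
    (hh : 0 < h) (θ : ℝ) :
    Integrable (fun z ↦ Real.exp (θ * z) *
      (atomTerm α σ h z + convTerm (kernelQPlus l₁ l₂ h) α σ h z)) ∧
    ∫ z, Real.exp (θ * z) * (atomTerm α σ h z + convTerm (kernelQPlus l₁ l₂ h) α σ h z) =
      Real.exp (l₁ * h) * NormedSpace.exp (h • (twoStateIntensity l₁ l₂ +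
        Matrix.diagonal fun e ↦ θ * α e)) 0 0 * Real.exp ((θ * σ) ^ 2 * h / 2) := by
  have hs : 0 < σ * √h := by positivity
  have hs2 : θ ^ 2 * (σ * √h) ^ 2 / 2 = (θ * σ) ^ 2 * h / 2 := by
    rw [mul_pow σ, Real.sq_sqrt hh.le]; ring
  have h1 := integrable_exp_mul_normalDensity hs θ (α 0 * h)
  have h2 := integral_exp_mul_mixture hs hh.le (m := fun u ↦ α 0 * u + α 1 * (h - u))
    (k := fun u ↦ 2 * returnKernel l₁ l₂ h (2 * u - h)) (by fun_prop)
    (continuous_const.mul (continuous_returnKernel.comp (by fun_prop))) θ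
  simp only [atomTerm_eq, convTerm_eq hα hh (kernelQPlus_eq hl₁ hl₂), mul_add]
  refine ⟨h1.add h2.1, ?_⟩
  rw [integral_add h1 h2.1, integral_exp_mul_normalDensity hs, h2.2, hs2,
    tilted_twoStateIntensity, (exp_smul_matrix_fin_two _ _ _ _ h).1,
    show θ * (α 0 * h) = l₁ * h + (-l₁ + θ * α 0) * h by ring, Real.exp_add]
  -- At `x = 2u - h` the kernel exponent is `(l₁ - l₂)(h - u) = l₁ h - l₁ u - l₂ (h - u)`: the
  -- diagonal of `Q` appears once `e^{l₁ h}` is taken out.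
  have hI : ∫ u in (0 : ℝ)..h, Real.exp (θ * (α 0 * u + α 1 * (h - u))) *
      (2 * returnKernel l₁ l₂ h (2 * u - h)) = Real.exp (l₁ * h) * ∫ u in (0 : ℝ)..h,
        Real.exp ((-l₁ + θ * α 0) * u + (-l₂ + θ * α 1) * (h - u)) *
          (l₁ * l₂ * u * besselSeries 1 (l₁ * l₂ * (u * (h - u)))) := by
    rw [← intervalIntegral.integral_const_mul]
    refine intervalIntegral.integral_congr fun u _ ↦ ?_
    simp only [returnKernel]
    rw [← mul_assoc (Real.exp (l₁ * h)), ← Real.exp_add,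
      show l₁ * h + ((-l₁ + θ * α 0) * u + (-l₂ + θ * α 1) * (h - u)) =
        θ * (α 0 * u + α 1 * (h - u)) + (l₁ - l₂) / 2 * (h - (2 * u - h)) by ring, Real.exp_add,
      show l₁ * l₂ * (h ^ 2 - (2 * u - h) ^ 2) / 4 = l₁ * l₂ * (u * (h - u)) by ring]
    ring
  rw [hI]
  ring

/-- The exponential moments of the unnormalised density on the event `ε_h = 2`. -/
lemma integral_exp_mul_switch (hl₁ : 0 < l₁) (hl₂ : 0 < l₂) (hα : α 0 ≠ α 1) (hσ : 0 < σ)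
    (hh : 0 < h) (θ : ℝ) :
    Integrable (fun z ↦ Real.exp (θ * z) * (l₁ * convTerm (kernelQMinus l₁ l₂ h) α σ h z)) ∧
    ∫ z, Real.exp (θ * z) * (l₁ * convTerm (kernelQMinus l₁ l₂ h) α σ h z) =
      Real.exp (l₁ * h) * NormedSpace.exp (h • (twoStateIntensity l₁ l₂ +
        Matrix.diagonal fun e ↦ θ * α e)) 0 1 * Real.exp ((θ * σ) ^ 2 * h / 2) := by
  have hs : 0 < σ * √h := by positivity
  have hs2 : θ ^ 2 * (σ * √h) ^ 2 / 2 = (θ * σ) ^ 2 * h / 2 := by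
    rw [mul_pow σ, Real.sq_sqrt hh.le]; ring
  have h2 := integral_exp_mul_mixture hs hh.le (m := fun u ↦ α 0 * u + α 1 * (h - u))
    (k := fun u ↦ 2 * switchKernel l₁ l₂ h (2 * u - h)) (by fun_prop)
    (continuous_const.mul (continuous_switchKernel.comp (by fun_prop))) θ
  simp only [convTerm_eq hα hh (kernelQMinus_eq hl₁ hl₂), mul_left_comm _ l₁]
  refine ⟨h2.1.const_mul l₁, ?_⟩
  rw [integral_const_mul, h2.2, hs2, tilted_twoStateIntensity, (exp_smul_matrix_fin_two _ _ _ _ h).2]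
  have hI : l₁ * ∫ u in (0 : ℝ)..h, Real.exp (θ * (α 0 * u + α 1 * (h - u))) *
      (2 * switchKernel l₁ l₂ h (2 * u - h)) = Real.exp (l₁ * h) * ∫ u in (0 : ℝ)..h,
        Real.exp ((-l₁ + θ * α 0) * u + (-l₂ + θ * α 1) * (h - u)) *
          (l₁ * besselSeries 0 (l₁ * l₂ * (u * (h - u)))) := by
    rw [← intervalIntegral.integral_const_mul, ← intervalIntegral.integral_const_mul]
    refine intervalIntegral.integral_congr fun u _ ↦ ?_
    simp only [switchKernel]
    rw [← mul_assoc (Real.exp (l₁ * h)), ← Real.exp_add,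
      show l₁ * h + ((-l₁ + θ * α 0) * u + (-l₂ + θ * α 1) * (h - u)) =
        θ * (α 0 * u + α 1 * (h - u)) + (l₁ - l₂) / 2 * (h - (2 * u - h)) by ring, Real.exp_add,
      show l₁ * l₂ * (h ^ 2 - (2 * u - h) ^ 2) / 4 = l₁ * l₂ * (u * (h - u)) by ring]
    ring
  rw [mul_left_comm, hI]
  ring

end

/-- If the exponential moments of `X` on the event `A` are, up to the factor `c`, those of `D`,
then `r * D` is the conditional density of `X` given `A`, with `r = c / P(A)`. -/
lemma isDensityOf_cond {Ω : Type*} [MeasurableSpace Ω] {P : Measure Ω} [IsProbabilityMeasure P]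
    {A : Set Ω} {X : Ω → ℝ} {D g : ℝ → ℝ} {c r : ℝ} (hPA : P.real A ≠ 0) (hX : AEMeasurable X P)
    (hD : Measurable D) (hD0 : ∀ z, 0 ≤ D z) (hr : 0 ≤ r) (hrc : r * P.real A = c)
    (hg : ∀ z, g z = r * D z)
    (hXint : ∀ θ : ℝ, IntegrableOn (fun ω ↦ Real.exp (θ * X ω)) A P)
    (hDint : ∀ θ : ℝ, Integrable fun z ↦ Real.exp (θ * z) * D z)
    (h : ∀ θ : ℝ, ∫ ω in A, Real.exp (θ * X ω) ∂P = c * ∫ z, Real.exp (θ * z) * D z) :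
    IsDensityOf g X P[|A] := by
  have hA : P A ≠ 0 := fun h0 ↦ hPA (by simp [measureReal_def, h0])
  obtain rfl : g = fun z ↦ r * D z := funext hg
  have : IsProbabilityMeasure P[|A] := cond_isProbabilityMeasure hA
  refine isDensityOf_of_integral_exp_mul (hX.mono_ac cond_absolutelyContinuous) (hD.const_mul r)
    (fun z ↦ mul_nonneg hr (hD0 z)) (fun θ ↦ ?_) (fun θ ↦ ?_) fun θ ↦ ?_
  · exact (hXint θ).smul_measure (ENNReal.inv_ne_top.2 hA)
  · simpa only [mul_left_comm _ r] using (hDint θ).const_mul r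
  · simp only [mul_left_comm _ r]
    rw [integral_cond, h, integral_const_mul, ← hrc]
    field_simp

end HiddenChain

/-- The conditional densities of the observation `Z_h` for a hidden two-state chain started in
state `1` (the element `0` of `Fin 2`), together with the convergence of the integrals in them. -/
theorem theorem3p2 {Ω : Type*} [MeasurableSpace Ω] (P : Measure Ω) [IsProbabilityMeasure P]
    (l₁ l₂ : ℝ) (hl₁ : 0 < l₁) (hl₂ : 0 < l₂)
    (α : Fin 2 → ℝ) (hα : α 0 ≠ α 1) (σ : ℝ) (hσ : 0 < σ)
    (T h : ℝ≥0) (hh : 0 < h) (hT : h ≤ T)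
    (ε : ℝ≥0 → Ω → Fin 2) (W : ℝ≥0 → Ω → ℝ)
    (hε : IsMarkovChainOn T (twoStateIntensity l₁ l₂) ε P)
    (hW : IsBrownianOn T W P)
    (hindep : IndepFun (fun ω (t : Set.Iic T) ↦ ε t ω) (fun ω (t : Set.Iic T) ↦ W t ω) P)
    (hstart : P {ω | ε 0 ω = 0} ≠ 0) :
    (∀ κ ∈ ({kernelP l₁ l₂ h, kernelQPlus l₁ l₂ h, kernelQMinus l₁ l₂ h} : Set (ℝ → ℝ)), ∀ z : ℝ,
      IntervalIntegrable (convIntegrand κ α σ h z) volume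
        (h * (meanDrift α - |halfGap α|)) (h * (meanDrift α + |halfGap α|))) ∧
    IsDensityOf (densityOne l₁ l₂ α σ h) (observation α σ ε W h)
      (P[|{ω | ε 0 ω = 0}]) ∧
    IsDensityOf (densityOneOne l₁ l₂ α σ h) (observation α σ ε W h)
      (P[|{ω | ε 0 ω = 0 ∧ ε h ω = 0}]) ∧
    IsDensityOf (densityOneTwo l₁ l₂ α σ h) (observation α σ ε W h)
      (P[|{ω | ε 0 ω = 0 ∧ ε h ω = 1}]) := by 
  have hh' : (0 : ℝ) < h := hh
  have hQP := kernelQPlus_eq (h := h) hl₁ hl₂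
  have hQM := kernelQMinus_eq (h := h) hl₁ hl₂
  have cR := continuous_returnKernel (l₁ := l₁) (l₂ := l₂) (h := h)
  have cS := continuous_switchKernel (l₁ := l₁) (l₂ := l₂) (h := h)
  have hP : ∀ y ∈ Set.Ico (-(h : ℝ)) h,
      kernelP l₁ l₂ h y = returnKernel l₁ l₂ h y + l₁ * switchKernel l₁ l₂ h y := by
    intro y hy
    simp only [kernelP_eq_add, hQP y hy, hQM y hy]
  refine ⟨?_, ?_⟩
  · rintro κ (rfl | rfl | rfl) z
    · exact intervalIntegrable_convIntegrand hα hh' (cR.add (cS.const_mul l₁)) hP z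
    · exact intervalIntegrable_convIntegrand hα hh' cR hQP z
    · exact intervalIntegrable_convIntegrand hα hh' cS hQM z
  set p := P.real {ω | ε 0 ω = 0}
  have hp : p ≠ 0 := fun h0 ↦ hstart ((measureReal_eq_zero_iff).1 h0)
  set D₀ : ℝ → ℝ := fun z ↦ atomTerm α σ h z + convTerm (kernelQPlus l₁ l₂ h) α σ h z
  set D₁ : ℝ → ℝ := fun z ↦ l₁ * convTerm (kernelQMinus l₁ l₂ h) α σ h z
  have hD₀m : Measurable D₀ := by
    have : Measurable (atomTerm α σ h) := by
      rw [funext atomTerm_eq]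
      exact Continuous.measurable (by fun_prop)
    exact this.add (measurable_convTerm hα hh' cR hQP)
  have hD₁m : Measurable D₁ := (measurable_convTerm hα hh' cS hQM).const_mul l₁
  have hD₀0 (z : ℝ) : 0 ≤ D₀ z := add_nonneg (normalDensity_nonneg (by positivity) _)
    (convTerm_nonneg hα hσ hh' hQP (returnKernel_nonneg hl₁ hl₂) z)
  have hD₁0 (z : ℝ) : 0 ≤ D₁ z := mul_nonneg hl₁.le
    (convTerm_nonneg hα hσ hh' hQM (switchKernel_nonneg hl₁ hl₂) z)
  have hX := aemeasurable_observation hε hW hh hT α σ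
  have hI₀ (θ : ℝ) := integral_exp_mul_return hl₁ hl₂ hα hσ hh' θ
  have hI₁ (θ : ℝ) := integral_exp_mul_switch hl₁ hl₂ hα hσ hh' θ
  have hX₀ (θ : ℝ) := setIntegral_exp_mul_observation hε hW hindep hh hT α σ θ 0 0
  have hX₁ (θ : ℝ) := setIntegral_exp_mul_observation hε hW hindep hh hT α σ θ 0 1
  have hexp : Real.exp (-l₁ * h) * Real.exp (l₁ * h) = 1 := by
    rw [← Real.exp_add]; simp
  have hEq₀ (θ : ℝ) : ∫ ω in {ω | ε 0 ω = 0 ∧ ε h ω = 0}, Real.exp (θ * observation α σ ε W h ω) ∂P =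
      p * Real.exp (-l₁ * h) * ∫ z, Real.exp (θ * z) * D₀ z := by
    rw [(hX₀ θ).2, (hI₀ θ).2]
    linear_combination (-p * NormedSpace.exp ((h : ℝ) • (twoStateIntensity l₁ l₂ +
      Matrix.diagonal fun e ↦ θ * α e)) 0 0 * Real.exp ((θ * σ) ^ 2 * h / 2)) * hexp
  have hEq₁ (θ : ℝ) : ∫ ω in {ω | ε 0 ω = 0 ∧ ε h ω = 1}, Real.exp (θ * observation α σ ε W h ω) ∂P =
      p * Real.exp (-l₁ * h) * ∫ z, Real.exp (θ * z) * D₁ z := by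
    rw [(hX₁ θ).2, (hI₁ θ).2]
    linear_combination (-p * NormedSpace.exp ((h : ℝ) • (twoStateIntensity l₁ l₂ +
      Matrix.diagonal fun e ↦ θ * α e)) 0 1 * Real.exp ((θ * σ) ^ 2 * h / 2)) * hexp
  -- The case `θ = 0` of the moment formula.
  have hprob (j : Fin 2) : P.real {ω | ε 0 ω = 0 ∧ ε h ω = j} =
      p * NormedSpace.exp ((h : ℝ) • twoStateIntensity l₁ l₂) 0 j := by
    have := (setIntegral_exp_mul_observation hε hW hindep hh hT α σ 0 0 j).2
    simpa using this
  have hE : Real.exp (-(l₁ + l₂) * h) = Real.exp (-l₁ * h) * Real.exp (-l₂ * h) := by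
    rw [← Real.exp_add]; congr 1; ring
  have hlt : Real.exp (-l₂ * h) < Real.exp (l₁ * h) := Real.exp_lt_exp.2 (by nlinarith)
  have hl : l₁ + l₂ ≠ 0 := by positivity
  have hprob₀ : (l₁ + l₂) * P.real {ω | ε 0 ω = 0 ∧ ε h ω = 0} =
      p * Real.exp (-l₁ * h) * (l₂ * Real.exp (l₁ * h) + l₁ * Real.exp (-l₂ * h)) := by
    rw [hprob, (exp_smul_twoStateIntensity hl₁ hl₂ h).1, hE, mul_left_comm, mul_div_cancel₀ _ hl]
    linear_combination (-p * l₂) * hexp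
  have hprob₁ : (l₁ + l₂) * P.real {ω | ε 0 ω = 0 ∧ ε h ω = 1} =
      l₁ * (p * Real.exp (-l₁ * h) * (Real.exp (l₁ * h) - Real.exp (-l₂ * h))) := by
    rw [hprob, (exp_smul_twoStateIntensity hl₁ hl₂ h).2, hE, mul_left_comm, mul_div_cancel₀ _ hl]
    linear_combination (-p * l₁) * hexp
  have hden₀ : l₂ * Real.exp (l₁ * h) + l₁ * Real.exp (-l₂ * h) ≠ 0 := by positivity
  have hden₁ : 0 < Real.exp (l₁ * h) - Real.exp (-l₂ * h) := sub_pos.2 hlt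
  have hexp0 := (Real.exp_pos (-l₁ * h)).ne'
  have hunion : {ω | ε 0 ω = 0} = {ω | ε 0 ω = 0 ∧ ε h ω = 0} ∪ {ω | ε 0 ω = 0 ∧ ε h ω = 1} := by
    ext ω
    simp only [Set.mem_ofPred_eq, Set.mem_union, ← and_or_left]
    exact (and_iff_left (by omega)).symm
  have hdisj : Disjoint {ω | ε 0 ω = 0 ∧ ε h ω = 0} {ω | ε 0 ω = 0 ∧ ε h ω = 1} := by
    refine Set.disjoint_left.2 fun ω h0 h1 ↦ ?_
    exact absurd (h0.2.symm.trans h1.2) (by decide)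
  refine ⟨?_, ?_, ?_⟩
  · refine isDensityOf_cond (D := fun z ↦ D₀ z + D₁ z) (c := p * Real.exp (-l₁ * h))
      (r := Real.exp (-l₁ * h)) hp hX (hD₀m.add hD₁m) (fun z ↦ add_nonneg (hD₀0 z) (hD₁0 z))
      (Real.exp_pos _).le (mul_comm _ _) (fun z ↦ ?_) (fun θ ↦ ?_) (fun θ ↦ ?_) fun θ ↦ ?_
    · rw [densityOne, kernelP_eq_add, convTerm_add_const_mul hα hh' cR cS hQP hQM, ← add_assoc]
    · rw [hunion]
      exact (hX₀ θ).1.union (hX₁ θ).1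
    · simp only [mul_add (Real.exp _)]
      exact (hI₀ θ).1.add (hI₁ θ).1
    · rw [hunion, setIntegral_union hdisj (hε.measurableSet_endpoints hT 0 1) (hX₀ θ).1 (hX₁ θ).1,
        hEq₀, hEq₁, ← mul_add, ← integral_add (hI₀ θ).1 (hI₁ θ).1]
      simp only [← mul_add]
      rfl
  · refine isDensityOf_cond (D := D₀) (c := p * Real.exp (-l₁ * h))
      (r := (l₁ + l₂) / (l₂ * Real.exp (l₁ * h) + l₁ * Real.exp (-l₂ * h)))
      (fun h0 ↦ ?_) hX hD₀m hD₀0 (by positivity) ?_ (fun z ↦ rfl) (fun θ ↦ (hX₀ θ).1)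
      (fun θ ↦ (hI₀ θ).1) hEq₀
    · rw [h0, mul_zero] at hprob₀
      exact mul_ne_zero (mul_ne_zero hp hexp0) hden₀ hprob₀.symm
    · rw [div_mul_eq_mul_div, hprob₀]
      field_simp
  -- The factor `l₁` carried by `D₁` cancels against the one in the probability of the event, hence
  -- the division by `l₁` in `r`.
  · refine isDensityOf_cond (D := D₁) (c := p * Real.exp (-l₁ * h))
      (r := (l₁ + l₂) / (Real.exp (l₁ * h) - Real.exp (-l₂ * h)) / l₁)
      (fun h0 ↦ ?_) hX hD₁m hD₁0 (by positivity) ?_ (fun z ↦ ?_) (fun θ ↦ (hX₁ θ).1)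
      (fun θ ↦ (hI₁ θ).1) hEq₁
    · rw [h0, mul_zero] at hprob₁
      exact mul_ne_zero hl₁.ne' (mul_ne_zero (mul_ne_zero hp hexp0) hden₁.ne') hprob₁.symm
    · rw [div_div, div_mul_eq_mul_div, hprob₁, div_eq_iff (mul_ne_zero hden₁.ne' hl₁.ne')]
      ring
    · simp only [densityOneTwo, D₁]
      field_simp
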